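/- Let $k$ be a field of characteristic $0$. **Modules.** Let $\mathbf{part}$ be the category of finite sets and partially defined maps. A $\mathbf{comm}_1$-module (a module over the operad of unital commutative algebras) is a functor $M:\mathbf{part}^{op}\to\{k\text{-vector spaces}\}$, or, in the differential graded case, a $\mathbb Z$-graded cochain complex of such functors. An element $x\in M([m])$, $[m]=\{1,\dots,m\}$, is viewed as an operation $x(a_1,\dots,a_m)$ with inputs labelled by $[m]$; pulling back along a partial map $f:X\rightharpoonup Y$ inserts $\prod_{f(a)=b}a$ into the input $b\in Y$ (the unit if no $a$ goes to $b$) and multiplies the result by the labels on which $f$ is undefined. **The derivation complex.** For a $\mathbf{comm}_1$-module $M$ concentrated in degree $0$ and $m\ge 1$ let $H(M)^{m-1}\subset M([m])$ be the space of all $x$ that vanish on signed shuffles, i.e. for all $0<p<m$ $$\sum_{\tau}\operatorname{sgn}(\tau)\,x(a_{\tau(1)},\dots,a_{\tau(m)})=0,$$ the sum being over all permutations $\tau$ such that $\tau^{-1}$ is increasing on $\{1,\dots,p\}$ and on $\{p+1,\dots,m\}$. The differential $H(M)^{m-1}\to H(M)^{m}$ is $$(dx)(a_1,\dots,a_{m+1})=a_1x(a_2,\dots,a_{m+1})+\sum_{i=1}^{m}(-1)^i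 x(\dots,a_ia_{i+1},\dots)+(-1)^{m+1}x(a_1,\dots,a_m)a_{m+1}.$$ For a complex $M$ of $\mathbf{comm}_1$-modules, $H(M)$ is the (direct sum) total complex of the bicomplex with entries $H(M^p)^q$, with differential $d_M+(-1)^p d$ in bidegree $(p,q)$. (This is the complex of derivations from the operad of homotopy commutative algebras, described by the values on its generators, including a generator of arity $1$.) **The modules $J(\mathfrak P_n)$.** Let $n\ge 0$, let $V$ be the vector space with basis $e_1,\dots,e_n$, and let $SV$ be the cofree symmetric coalgebra on $V$ (the polynomial algebra on $V$ with $V$ primitive), $\mathbb Z^n$-graded by the number of occurrences of each $e_i$. Put $$J_n(X)=\Big(\bigotimes_{x\in X}SV\Big)^{(1,1,\dots,1)},$$ the part of multidegree $(1,\dots,1)$. A partial map $f:X\rightharpoonup Y$ acts as $J_n(Y)\to J_n(X)$ by applying to the factor $y$ the iterated coproduct with values in the factors $x\in f^{-1}(y)$ (the counit if $f^{-1}(y)=\emptyset$) and by putting $1$ into the factors $x$ at which $f$ is undefined. The group $S_n$ acts on $J_n$ by permuting the $e_i$. For a $\mathbb Z$-graded cochain complex $\mathfrak P_n$ of representations of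 $S_n$ over $k$ let $J(\mathfrak P_n)(X)=(J_n(X)\otimes\mathfrak P_n)^{S_n}$. **Theorem.** If $n\neq 1$, then the complex $H(J(\mathfrak P_n))$ is acyclic for every complex $\mathfrak P_n$ of representations of $S_n$. If $n=1$, then for every complex $\mathfrak P_1$ there is a quasi-isomorphism $\mathfrak P_1\to H(J(\mathfrak P_1))$. -/

import Mathlib

open CategoryTheory Opposite

universe u

namespace CommOne

/-- A finite set, as an object of the category of finite sets and partially defined maps. -/
structure FinPart : Type 1 where
  carrier : Type
  [fintype : Fintype carrier]

attribute [instance] FinPart.fintype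

namespace FinPart

/-- A partially defined map: `toFun x = none` means that the map is undefined at `x`. -/
@[ext]
structure Hom (X Y : FinPart) : Type where
  toFun : X.carrier → Option Y.carrier

/-- The category `part` of finite sets and partially defined maps. -/
instance category : Category FinPart where
  Hom := Hom
  id _ := ⟨some⟩
  comp f g := ⟨fun x => (f.toFun x).bind g.toFun⟩
  id_comp _ := by ext; simp
  comp_id _ := by ext; simp
  assoc _ _ _ := by ext; simp [Option.bind_assoc]

@[ext] theorem hom_ext {X Y : FinPart} {f g : X ⟶ Y} (h : ∀ x, f.toFun x = g.toFun x) : f = g :=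
  Hom.ext (funext h)

@[simp] theorem comp_toFun {X Y Z : FinPart} (f : X ⟶ Y) (g : Y ⟶ Z) (x : X.carrier) :
    (f ≫ g).toFun x = (f.toFun x).bind g.toFun := rfl

@[simp] theorem id_toFun {X : FinPart} (x : X.carrier) : Hom.toFun (𝟙 X) x = some x := rfl

/-- The finite set `{0, …, m - 1}`. -/
abbrev fin (m : ℕ) : FinPart := ⟨Fin m⟩

/-- A permutation, as an (everywhere defined) partial map. -/
def perm {m : ℕ} (σ : Equiv.Perm (Fin m)) : fin m ⟶ fin m := ⟨fun a => some (σ a)⟩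

/-- The partial maps `{0, …, m} ⇀ {0, …, m - 1}` (`0 ≤ i ≤ m + 1`) of the bar construction: for
`i = 0` the point `0` is dropped, for `i = m + 1` the point `m` is dropped, and for `1 ≤ i ≤ m` the
map is everywhere defined, monotone, and merges `i - 1` with `i`. -/
def coface (m : ℕ) (i : Fin (m + 2)) : fin (m + 1) ⟶ fin m :=
  ⟨fun a => if a.val < i.val then (if h : a.val < m then some ⟨a.val, h⟩ else none)
    else (if h : 0 < a.val then some ⟨a.val - 1, by omega⟩ else none)⟩

theorem coface_comp_coface (m : ℕ) (i : Fin (m + 2)) (j : Fin (m + 3)) (h : i.val < j.val) :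
    coface (m + 1) j ≫ coface m i =
      coface (m + 1) ⟨i.val, by omega⟩ ≫ coface m ⟨j.val - 1, by omega⟩ := by
  ext a : 1
  obtain ⟨a, ha⟩ := a
  obtain ⟨i, hi⟩ := i
  obtain ⟨j, hj⟩ := j
  simp only [coface, comp_toFun] at h ⊢
  split_ifs <;> simp only [Option.bind_some, Option.bind_none] <;> split_ifs <;>
    (try simp only [Option.some.injEq, Fin.mk.injEq]) <;> first | rfl | omega

end FinPart

open FinPart

/-- A module over the operad of unital commutative algebras, that is, a contravariant functor from
finite sets and partial maps to vector spaces. For `M(X)`, whose elements are thought of as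
operations with inputs labelled by `X`, pulling back along a map of sets inserts products
`∏_{x ∈ f⁻¹(y)} x` (the unit, if the fibre is empty) into the inputs `y`, and pulling back along a
partial map moreover multiplies by the labels at which the map is undefined. -/
abbrev Comm1Mod (k : Type u) [Field k] := FinPartᵒᵖ ⥤ ModuleCat.{u} k

variable {k : Type u} [Field k]

/-- The action `f^* : M(Y) → M(X)` of a partial map `f : X ⇀ Y`. -/
abbrev pull (M : Comm1Mod k) {X Y : FinPart} (f : X ⟶ Y) : M.obj (op Y) →ₗ[k] M.obj (op X) :=
  (M.map f.op).hom

theorem pull_comp (M : Comm1Mod k) {X Y Z : FinPart} (f : X ⟶ Y) (g : Y ⟶ Z) (x : M.obj (op Z)) :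
    pull M (f ≫ g) x = pull M f (pull M g x) := by
  simp [pull]

theorem pull_natural {M N : Comm1Mod k} (φ : M ⟶ N) {X Y : FinPart} (f : X ⟶ Y) (x : M.obj (op Y)) :
    (φ.app (op X)).hom (pull M f x) = pull N f ((φ.app (op Y)).hom x) := by
  simp

/-- The differential `dx`, where `dx(a₁, …, aₘ₊₁)` equals
`a₁ x(a₂, …, aₘ₊₁) + ∑ (-1)ⁱ x(…, aᵢ aᵢ₊₁, …) + (-1)ᵐ⁺¹ x(a₁, …, aₘ) aₘ₊₁` (sum over `1 ≤ i ≤ m`). -/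
noncomputable def hochschild (M : Comm1Mod k) (m : ℕ) :
    M.obj (op (fin m)) →ₗ[k] M.obj (op (fin (m + 1))) :=
  ∑ i : Fin (m + 2), (-1 : ℤ) ^ (i : ℕ) • pull M (coface m i)

theorem hochschild_apply (M : Comm1Mod k) (m : ℕ) (x : M.obj (op (fin m))) :
    hochschild M m x = ∑ i : Fin (m + 2), (-1 : ℤ) ^ (i : ℕ) • pull M (coface m i) x := by
  simp [hochschild]

theorem hochschild_sq (M : Comm1Mod k) (m : ℕ) (x : M.obj (op (fin m))) :
    hochschild M (m + 1) (hochschild M m x) = 0 := by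
  simp only [hochschild_apply, map_sum, map_zsmul, Finset.smul_sum, smul_smul, ← pow_add,
    ← pull_comp]
  rw [Finset.sum_comm]
  simp only [add_comm (Fin.val (n := m + 2) _)]
  rw [← Finset.sum_product' (Finset.univ : Finset (Fin (m + 3)))
    (Finset.univ : Finset (Fin (m + 2)))
    (fun j i => (-1 : ℤ) ^ (j.val + i.val) • pull M (coface (m + 1) j ≫ coface m i) x)]
  refine Finset.sum_involution
    (fun ji _ => if h : ji.2.val < ji.1.val then (⟨ji.2.val, by omega⟩, ⟨ji.1.val - 1, by omega⟩)
      else (⟨ji.2.val + 1, by omega⟩, ⟨ji.1.val, by omega⟩)) ?_ ?_ ?_ ?_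
  · rintro ⟨j, i⟩ -
    dsimp only
    split_ifs with h
    · rw [coface_comp_coface m i j h, ← add_smul]
      have : j.val + i.val = (i.val + (j.val - 1)) + 1 := by omega
      simp only [this, pow_succ]
      simp
    · have := coface_comp_coface m ⟨j.val, by omega⟩ ⟨i.val + 1, by omega⟩ (by simp; omega)
      rw [this]
      change (-1 : ℤ) ^ (j.val + i.val) • pull M (coface (m + 1) j ≫ coface m i) x +
        (-1 : ℤ) ^ (i.val + 1 + j.val) • pull M (coface (m + 1) j ≫ coface m i) x = 0
      have e : i.val + 1 + j.val = (j.val + i.val) + 1 := by omega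
      rw [← add_smul, e, pow_succ]
      simp
  · rintro ⟨j, i⟩ - - hne
    dsimp only at hne
    split_ifs at hne with h <;> simp [Prod.ext_iff, Fin.ext_iff] at hne <;> omega
  · intros; simp
  · rintro ⟨j, i⟩ -
    dsimp only
    split_ifs with h h' h' <;> simp only [Prod.ext_iff, Fin.ext_iff] at * <;> simp at * <;> omega

/-- `σ` is a shuffle of the first `p` labels with the remaining `m - p` labels: the label `a` is put
into the place `σ a`, and inside both blocks the order of the labels is kept. -/
def IsShuffle {m : ℕ} (p : ℕ) (σ : Equiv.Perm (Fin m)) : Prop :=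
  ∀ a b : Fin m, a < b → (b.val < p ∨ p ≤ a.val) → σ a < σ b

open Classical in
/-- The signed sum of `x(a_{τ(1)}, …, a_{τ(m)})` over all shuffles (`σ = τ⁻¹`) of the first `p` labels
with the remaining ones. -/
noncomputable def shuffleSum (M : Comm1Mod k) (m p : ℕ) :
    M.obj (op (fin m)) →ₗ[k] M.obj (op (fin m)) :=
  ∑ σ : Equiv.Perm (Fin m) with IsShuffle p σ, (Equiv.Perm.sign σ : ℤ) • pull M (perm σ)

/-- The elements of `M({0, …, m - 1})` that vanish on all signed shuffles of two nonempty blocks.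
Equivalently: the `Sₘ`-equivariant maps to `M` from the `Sₘ`-module spanned by the generator of
arity `m` of the operad of homotopy commutative algebras. -/
noncomputable def harrison (M : Comm1Mod k) (m : ℕ) : Submodule k (M.obj (op (fin m))) :=
  ⨅ p ∈ Set.Ioo 0 m, LinearMap.ker (shuffleSum M m p)

theorem mem_harrison (M : Comm1Mod k) (m : ℕ) (x : M.obj (op (fin m))) :
    x ∈ harrison M m ↔ ∀ p, 0 < p → p < m → shuffleSum M m p x = 0 := by
  simp [harrison]

/-- Insertion of the value `i` at the place `a` into a permutation. -/
def ins {m : ℕ} (a i : Fin (m + 1)) (g : Equiv.Perm (Fin m)) : Equiv.Perm (Fin (m + 1)) :=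
  i.cycleRange⁻¹ * Equiv.Perm.decomposeFin.symm (0, g) * a.cycleRange

theorem ins_self {m : ℕ} (a i : Fin (m + 1)) (g : Equiv.Perm (Fin m)) : ins a i g a = i := by
  simp [ins, Equiv.Perm.inv_def]

theorem ins_succAbove {m : ℕ} (a i : Fin (m + 1)) (g : Equiv.Perm (Fin m)) (b : Fin m) :
    ins a i g (a.succAbove b) = i.succAbove (g b) := by
  simp [ins, Equiv.Perm.inv_def]

theorem sign_ins {m : ℕ} (a i : Fin (m + 1)) (g : Equiv.Perm (Fin m)) :
    (Equiv.Perm.sign (ins a i g) : ℤ) = (-1) ^ (i : ℕ) * (-1) ^ (a : ℕ) * Equiv.Perm.sign g := by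
  simp [ins, Fin.sign_cycleRange]
  ring

theorem ins_bijective {m : ℕ} (i : Fin (m + 1)) :
    Function.Bijective (fun ag : Fin (m + 1) × Equiv.Perm (Fin m) => ins ag.1 i ag.2) := by
  rw [Fintype.bijective_iff_injective_and_card]
  constructor
  · rintro ⟨a, g⟩ ⟨a', g'⟩ h
    dsimp only at h
    have ha : a = a' := by
      apply (ins a i g).injective
      rw [ins_self, h, ins_self]
    subst ha
    have : g = g' := by
      ext b : 1
      apply i.succAbove_right_injective
      rw [← ins_succAbove a i g, h, ins_succAbove]
    rw [this]
  · simp [Fintype.card_perm, Nat.factorial_succ]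

theorem sum_ins {A : Type*} [AddCommMonoid A] {m : ℕ} (i : Fin (m + 1))
    (F : Equiv.Perm (Fin (m + 1)) → A) :
    ∑ f, F f = ∑ a : Fin (m + 1), ∑ g : Equiv.Perm (Fin m), F (ins a i g) := by
  rw [← Fintype.sum_prod_type', ← (ins_bijective i).sum_comp]

/-- The size of the first block after removal of the label `a`. -/
def blk {m : ℕ} (p : ℕ) (a : Fin (m + 1)) : ℕ := if a.val < p then p - 1 else p

/-- The label that precedes `a` in its block, if there is one. -/
def prd {m : ℕ} (p : ℕ) (a : Fin (m + 1)) : Option (Fin m) :=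
  if h : a.val = 0 ∨ a.val = p then none else some ⟨a.val - 1, by omega⟩

/-- The partial map that sends the label `a` to `o` and is monotone bijective on the other labels. -/
def mrg {m : ℕ} (a : Fin (m + 1)) (o : Option (Fin m)) : fin (m + 1) ⟶ fin m :=
  ⟨a.insertNth (α := fun _ => Option (Fin m)) o some⟩

theorem perm_ins_comp {m : ℕ} (a i : Fin (m + 1)) (g : Equiv.Perm (Fin m)) (o : Option (Fin m))
    (h : (o = none ∧ i.val = 0) ∨ ∃ b, o = some b ∧ i.val = (g b).val + 1) :
    perm (ins a i g) ≫ coface m i.castSucc = mrg a o ≫ perm g := by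
  ext c : 1
  rcases Fin.eq_self_or_eq_succAbove a c with rfl | ⟨b, rfl⟩
  · simp only [mrg, perm, coface, comp_toFun, Fin.insertNth_apply_same, ins_self, Option.bind_some,
      Fin.val_castSucc, lt_irrefl, if_false]
    rcases h with ⟨rfl, h⟩ | ⟨b, rfl, h⟩
    · simp [h]
    · simp [h]
  · simp only [mrg, perm, coface, comp_toFun, Fin.insertNth_apply_succAbove, ins_succAbove,
      Option.bind_some, Fin.val_castSucc]
    have := (g b).isLt
    simp only [Fin.succAbove, Fin.lt_def, Fin.val_castSucc]
    by_cases h1 : (g b).val < i.val <;> simp [h1]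
    omega

theorem perm_ins_comp_last {m : ℕ} (a : Fin (m + 1)) (g : Equiv.Perm (Fin m)) :
    perm (ins a (Fin.last m) g) ≫ coface m (Fin.last (m + 1)) = mrg a none ≫ perm g := by
  ext c : 1
  rcases Fin.eq_self_or_eq_succAbove a c with rfl | ⟨b, rfl⟩
  · simp [mrg, perm, coface, ins_self]
  · simp only [mrg, perm, coface, comp_toFun, Fin.insertNth_apply_succAbove, ins_succAbove,
      Option.bind_some, Fin.succAbove_last]
    simp

/-- The places `i - 1` and `i` are occupied by labels of different blocks. -/
def Mixed {m : ℕ} (p : ℕ) (i : ℕ) (f : Equiv.Perm (Fin (m + 1))) : Prop :=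
  ∃ b c : Fin (m + 1), (f b).val + 1 = i ∧ (f c).val = i ∧ ¬ (b.val < p ↔ c.val < p)

theorem shuffle_ins {m : ℕ} {p : ℕ} {a i : Fin (m + 1)} {g : Equiv.Perm (Fin m)}
    (h : IsShuffle p (ins a i g)) : IsShuffle (blk p a) g := by
  intro b c hbc hp
  have h1 : a.succAbove b < a.succAbove c := (Fin.strictMono_succAbove a) hbc
  have h2 := h _ _ h1 (by
    simp only [blk] at hp
    simp only [Fin.succAbove, Fin.lt_def, Fin.val_castSucc] at hbc ⊢
    split_ifs at hp ⊢ <;> simp <;> omega)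
  rw [ins_succAbove, ins_succAbove] at h2
  exact (Fin.strictMono_succAbove i).lt_iff_lt.1 h2

theorem shuffle_ins_iff {m : ℕ} {p : ℕ} (hp : 0 < p)
    (a i : Fin (m + 1)) (g : Equiv.Perm (Fin m)) :
    (IsShuffle p (ins a i g) ∧ ¬ Mixed p i (ins a i g)) ↔
      (IsShuffle (blk p a) g ∧
        ((prd p a = none ∧ i.val = 0) ∨ ∃ b, prd p a = some b ∧ i.val = (g b).val + 1)) := by
  have hfa := ins_self a i g
  have hfs := ins_succAbove a i g
  constructor
  · rintro ⟨hs, hm⟩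
    refine ⟨shuffle_ins hs, ?_⟩
    by_cases hi : i.val = 0
    · left
      refine ⟨?_, hi⟩
      simp only [prd, dite_eq_left_iff, reduceCtorEq, imp_false, not_not]
      by_contra hne
      have := hs ⟨a.val - 1, by omega⟩ a (show a.val - 1 < a.val by omega) (by simp; omega)
      rw [hfa, Fin.lt_def] at this
      omega
    · right
      obtain ⟨c, hc⟩ := (ins a i g).surjective ⟨i.val - 1, by omega⟩
      have hblk : c.val < p ↔ a.val < p := by
        by_contra hne
        exact hm ⟨c, a, by rw [hc]; simp; omega, by rw [hfa], hne⟩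
      have hca : c < a := by
        rcases lt_trichotomy c a with h | h | h
        · exact h
        · rw [h, hfa, Fin.ext_iff] at hc
          simp at hc
          omega
        · have := hs a c h (by omega)
          rw [hfa, hc, Fin.lt_def] at this
          simp at this
          omega
      have hca' := Fin.lt_def.1 hca
      have hc1 : c.val + 1 = a.val := by
        by_contra hne
        have h1 := hs c ⟨a.val - 1, by omega⟩ (show c.val < a.val - 1 by omega) (by simp; omega)
        have h2 := hs ⟨a.val - 1, by omega⟩ a (show a.val - 1 < a.val by omega) (by simp; omega)
        rw [hc, Fin.lt_def] at h1
        rw [hfa, Fin.lt_def] at h2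
        simp at h1
        omega
      refine ⟨⟨c.val, by omega⟩, ?_, ?_⟩
      · have : ¬ (a.val = 0 ∨ a.val = p) := by omega
        simp only [prd, this, dite_false]
        simp
        omega
      · have h3 := hfs ⟨c.val, by omega⟩
        have h4 : a.succAbove ⟨c.val, by omega⟩ = c := by
          rw [Fin.succAbove_of_castSucc_lt _ _ (show c.val < a.val by omega)]
          rfl
        rw [h4, hc, Fin.ext_iff] at h3
        simp only [Fin.succAbove, Fin.lt_def, Fin.val_castSucc] at h3
        split_ifs at h3 with h5 <;> simp at h3 <;> omega
  · rintro ⟨hs, hi⟩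
    have key : ∀ b, prd p a = some b → b.val + 1 = a.val ∧ a.val ≠ p := by
      intro b hb
      simp only [prd] at hb
      split_ifs at hb with h
      simp only [Option.some.injEq, Fin.ext_iff] at hb
      omega
    have key0 : prd p a = none → a.val = 0 ∨ a.val = p := by
      intro hb
      simp only [prd] at hb
      split_ifs at hb with h
      exact h
    constructor
    · intro c d hcd hblk
      have hcd' := Fin.lt_def.1 hcd
      rcases Fin.eq_self_or_eq_succAbove a c with rfl | ⟨b, rfl⟩
      · rcases Fin.eq_self_or_eq_succAbove c d with rfl | ⟨e, rfl⟩
        · omega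
        · rw [hfa, hfs]
          have he : c.val ≤ e.val := by
            simp only [Fin.succAbove, Fin.lt_def, Fin.val_castSucc] at hcd'
            split_ifs at hcd' <;> simp at hcd' <;> omega
          have he2 : (c.succAbove e).val = e.val + 1 := by
            simp only [Fin.succAbove, Fin.lt_def, Fin.val_castSucc]
            rw [if_neg (by omega)]
            simp
          have hge : i.val ≤ (g e).val := by
            rcases hi with ⟨_, hi⟩ | ⟨b, hb, hi⟩
            · omega
            · obtain ⟨h1, h2⟩ := key b hb
              have := hs b e (Fin.lt_def.2 (by omega)) (by
                simp only [blk]; split_ifs <;> omega)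
              rw [Fin.lt_def] at this
              omega
          simp only [Fin.succAbove, Fin.lt_def, Fin.val_castSucc]
          rw [if_neg (by omega)]
          simp
          omega
      · rcases Fin.eq_self_or_eq_succAbove a d with rfl | ⟨e, rfl⟩
        · rw [hfa, hfs]
          have he : b.val < d.val := by
            simp only [Fin.succAbove, Fin.lt_def, Fin.val_castSucc] at hcd'
            split_ifs at hcd' <;> simp at hcd' <;> omega
          have he2 : (d.succAbove b).val = b.val := by
            simp only [Fin.succAbove, Fin.lt_def, Fin.val_castSucc]
            rw [if_pos (by omega)]
            simp
          have hge : (g b).val < i.val := by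
            rcases hi with ⟨h0, hi⟩ | ⟨e, hb, hi⟩
            · have := key0 h0
              omega
            · obtain ⟨h1, h2⟩ := key e hb
              by_cases hbe : b = e
              · subst hbe; omega
              · rw [Fin.ext_iff] at hbe
                have := hs b e (Fin.lt_def.2 (by omega)) (by
                  simp only [blk]; split_ifs <;> omega)
                rw [Fin.lt_def] at this
                omega
          simp only [Fin.succAbove, Fin.lt_def, Fin.val_castSucc]
          rw [if_pos (by omega)]
          simp
          omega
        · rw [hfs, hfs]
          apply Fin.strictMono_succAbove i
          have hbe : b < e := (Fin.strictMono_succAbove a).lt_iff_lt.1 hcd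
          apply hs _ _ hbe
          rw [Fin.lt_def] at hbe
          simp only [blk]
          simp only [Fin.succAbove, Fin.lt_def, Fin.val_castSucc] at hblk
          split_ifs at hblk ⊢ <;> simp at hblk <;> omega
    · rintro ⟨b, c, hb, hc, hne⟩
      have hca : c = a := (ins a i g).injective (by rw [hfa]; exact Fin.ext hc)
      subst hca
      rcases hi with ⟨_, hi⟩ | ⟨e, he, hi⟩
      · omega
      · obtain ⟨h1, h2⟩ := key e he
        have he2 : (c.succAbove e).val = e.val := by
          simp only [Fin.succAbove, Fin.lt_def, Fin.val_castSucc]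
          rw [if_pos (by omega)]
          simp
        have hbe : b = c.succAbove e := (ins c i g).injective (by
          rw [hfs]
          apply Fin.ext
          simp only [Fin.succAbove, Fin.lt_def, Fin.val_castSucc]
          rw [if_pos (by omega)]
          simp
          omega)
        rw [hbe, he2] at hne
        omega

theorem shuffle_ins_last_iff {m : ℕ} {p : ℕ} (hp : 0 < p) (hpm : p < m + 1)
    (a : Fin (m + 1)) (g : Equiv.Perm (Fin m)) :
    IsShuffle p (ins a (Fin.last m) g) ↔
      (IsShuffle (blk p a) g ∧ (a.val + 1 = p ∨ a.val = m)) := by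
  have hfa := ins_self a (Fin.last m) g
  have hfs := ins_succAbove a (Fin.last m) g
  constructor
  · intro hs
    refine ⟨shuffle_ins hs, ?_⟩
    by_contra hne
    have := hs a ⟨a.val + 1, by omega⟩ (show a.val < a.val + 1 by omega) (by simp; omega)
    rw [hfa] at this
    exact absurd this (Fin.le_last _).not_gt
  · rintro ⟨hs, ha⟩ c d hcd hblk
    have hcd' := Fin.lt_def.1 hcd
    have hd := d.isLt
    rcases Fin.eq_self_or_eq_succAbove a c with rfl | ⟨b, rfl⟩
    · omega
    · rcases Fin.eq_self_or_eq_succAbove a d with rfl | ⟨e, rfl⟩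
      · rw [hfa, hfs, Fin.succAbove_last]
        exact Fin.castSucc_lt_last _
      · rw [hfs, hfs]
        apply Fin.strictMono_succAbove
        have hbe : b < e := (Fin.strictMono_succAbove a).lt_iff_lt.1 hcd
        apply hs _ _ hbe
        rw [Fin.lt_def] at hbe
        simp only [blk]
        simp only [Fin.succAbove, Fin.lt_def, Fin.val_castSucc] at hblk
        split_ifs at hblk ⊢ <;> simp at hblk <;> omega

theorem shuffleSum_apply (M : Comm1Mod k) (m p : ℕ) (x : M.obj (op (fin m))) :
    shuffleSum M m p x = ∑ σ : Equiv.Perm (Fin m), open Classical in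
      if IsShuffle p σ then (Equiv.Perm.sign σ : ℤ) • pull M (perm σ) x else 0 := by
  simp only [shuffleSum, Finset.sum_filter, LinearMap.sum_apply]
  refine Finset.sum_congr rfl fun σ _ => ?_
  split_ifs <;> rfl

open Classical in
theorem sum_mixed (M : Comm1Mod k) (m p : ℕ) (x : M.obj (op (fin m))) (i : Fin (m + 1)) :
    ∑ f : Equiv.Perm (Fin (m + 1)), (if IsShuffle p f ∧ Mixed p i f then
      (Equiv.Perm.sign f : ℤ) • pull M (perm f ≫ coface m i.castSucc) x else 0) = 0 := by
  rw [← Finset.sum_filter]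
  by_cases hi : i.val = 0
  · rw [Finset.filter_false_of_mem, Finset.sum_empty]
    rintro f - ⟨-, b, c, hb, hc, -⟩
    omega
  have hlt := i.isLt
  set j : Fin (m + 1) := ⟨i.val - 1, by omega⟩ with hj
  have hji : j ≠ i := by rw [Ne, Fin.ext_iff]; simp [hj]; omega
  refine Finset.sum_involution (fun f _ => Equiv.swap j i * f) ?_ ?_ ?_ ?_
  · intro f _
    have h1 : perm (Equiv.swap j i * f) ≫ coface m i.castSucc = perm f ≫ coface m i.castSucc := by
      ext a : 1
      simp only [perm, comp_toFun, Option.bind_some, Equiv.Perm.coe_mul, Function.comp_apply]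
      by_cases ha : f a = j
      · rw [ha, Equiv.swap_apply_left]
        simp only [coface, hj, Fin.val_castSucc, lt_irrefl, if_false]
        rw [dif_pos (by omega), if_pos (by omega), dif_pos (by omega)]
      · by_cases ha' : f a = i
        · rw [ha', Equiv.swap_apply_right]
          simp only [coface, hj, Fin.val_castSucc, lt_irrefl, if_false]
          rw [dif_pos (by omega), if_pos (by omega), dif_pos (by omega)]
        · rw [Equiv.swap_apply_of_ne_of_ne ha ha']
    rw [h1, Equiv.Perm.sign_mul, Equiv.Perm.sign_swap hji]
    simp
  · intro f _ _ h
    have := congrArg Equiv.Perm.sign h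
    rw [Equiv.Perm.sign_mul, Equiv.Perm.sign_swap hji] at this
    simp at this
  · intro f hf
    simp only [Finset.mem_filter, Finset.mem_univ, true_and] at hf ⊢
    obtain ⟨hs, b, c, hb, hc, hne⟩ := hf
    have hb' : f b = j := Fin.ext (by simp [hj]; omega)
    have hc' : f c = i := Fin.ext hc
    refine ⟨?_, c, b, ?_, ?_, ?_⟩
    · intro a d had hblk
      have hlt := hs a d had hblk
      have hnot : ¬ (f a = j ∧ f d = i) := by
        rintro ⟨h1, h2⟩
        rw [← hb'] at h1
        rw [← hc'] at h2
        have h1 := f.injective h1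
        have h2 := f.injective h2
        subst h1 h2
        rw [Fin.lt_def] at had
        omega
      have hjv : j.val = i.val - 1 := rfl
      rw [Fin.ext_iff, Fin.ext_iff] at hnot
      simp only [Equiv.Perm.coe_mul, Function.comp_apply, Equiv.swap_apply_def, Fin.ext_iff]
      rw [Fin.lt_def] at hlt ⊢
      split_ifs <;> omega
    · simp [hc', hj]; omega
    · simp [hb']
    · tauto
  · intro f _
    rw [← mul_assoc, Equiv.swap_mul_self, one_mul]

open Classical in
theorem shuffleSum_hochschild (M : Comm1Mod k) (m : ℕ) (x : M.obj (op (fin m)))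
    (hx : x ∈ harrison M m) (p : ℕ) (hp : 0 < p) (hpm : p < m + 1) :
    shuffleSum M (m + 1) p (hochschild M m x) = 0 := by
  rw [mem_harrison] at hx
  have hterm : ∀ i : Fin (m + 1), ∑ f : Equiv.Perm (Fin (m + 1)), (if IsShuffle p f then
      ((-1 : ℤ) ^ (i : ℕ) * Equiv.Perm.sign f) • pull M (perm f ≫ coface m i.castSucc) x else 0) =
      ∑ a : Fin (m + 1), ∑ g : Equiv.Perm (Fin m), (if IsShuffle (blk p a) g ∧
        ((prd p a = none ∧ i.val = 0) ∨ ∃ b, prd p a = some b ∧ i.val = (g b).val + 1) then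
        ((-1 : ℤ) ^ (a : ℕ) * Equiv.Perm.sign g) • pull M (mrg a (prd p a) ≫ perm g) x else 0) := by
    intro i
    have h1 : ∀ f : Equiv.Perm (Fin (m + 1)), (if IsShuffle p f then
        ((-1 : ℤ) ^ (i : ℕ) * Equiv.Perm.sign f) • pull M (perm f ≫ coface m i.castSucc) x else 0) =
        (-1 : ℤ) ^ (i : ℕ) • (if IsShuffle p f ∧ Mixed p i f then
          (Equiv.Perm.sign f : ℤ) • pull M (perm f ≫ coface m i.castSucc) x else 0) +
        (if IsShuffle p f ∧ ¬ Mixed p i f then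
        ((-1 : ℤ) ^ (i : ℕ) * Equiv.Perm.sign f) • pull M (perm f ≫ coface m i.castSucc) x
          else 0) := by
      intro f
      by_cases h : IsShuffle p f <;> by_cases h' : Mixed p i f <;> simp [h, h', smul_smul]
    rw [Finset.sum_congr rfl (fun f _ => h1 f), Finset.sum_add_distrib, ← Finset.smul_sum,
      sum_mixed, smul_zero, zero_add, sum_ins i]
    refine Finset.sum_congr rfl fun a _ => Finset.sum_congr rfl fun g _ => ?_
    simp only [shuffle_ins_iff hp a i g]
    split_ifs with h
    · rw [perm_ins_comp a i g _ h.2, sign_ins]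
      congr 1
      rw [← mul_assoc, ← mul_assoc, ← pow_add, Even.neg_one_pow ⟨_, rfl⟩, one_mul]
    · rfl
  have hlast : ∑ f : Equiv.Perm (Fin (m + 1)), (if IsShuffle p f then
      ((-1 : ℤ) ^ (m + 1) * Equiv.Perm.sign f) • pull M (perm f ≫ coface m (Fin.last _)) x else 0) =
      ∑ a : Fin (m + 1), if a.val + 1 = p ∨ a.val = m then
        -((-1 : ℤ) ^ (a : ℕ) • pull M (mrg a none) (shuffleSum M m (blk p a) x)) else 0 := by
    rw [sum_ins (Fin.last m)]
    refine Finset.sum_congr rfl fun a _ => ?_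
    split_ifs with h
    · rw [shuffleSum_apply, map_sum, Finset.smul_sum, ← Finset.sum_neg_distrib]
      refine Finset.sum_congr rfl fun g _ => ?_
      simp only [shuffle_ins_last_iff hp hpm a g, h, and_true]
      split_ifs
      · rw [perm_ins_comp_last, sign_ins, map_zsmul, pull_comp, smul_smul, ← neg_smul]
        congr 1
        rw [← mul_assoc, ← mul_assoc, Fin.val_last, ← pow_add, Odd.neg_one_pow ⟨m, by ring⟩]
        ring
      · simp
    · refine Finset.sum_eq_zero fun g _ => ?_
      rw [if_neg]
      rw [shuffle_ins_last_iff hp hpm a g]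
      tauto
  have hmain : ∑ i : Fin (m + 1), ∑ a : Fin (m + 1), ∑ g : Equiv.Perm (Fin m),
      (if IsShuffle (blk p a) g ∧
        ((prd p a = none ∧ i.val = 0) ∨ ∃ b, prd p a = some b ∧ i.val = (g b).val + 1) then
        ((-1 : ℤ) ^ (a : ℕ) * Equiv.Perm.sign g) • pull M (mrg a (prd p a) ≫ perm g) x else 0) =
      ∑ a : Fin (m + 1),
        (-1 : ℤ) ^ (a : ℕ) • pull M (mrg a (prd p a)) (shuffleSum M m (blk p a) x) := by
    rw [Finset.sum_comm]
    refine Finset.sum_congr rfl fun a _ => ?_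
    rw [Finset.sum_comm, shuffleSum_apply, map_sum, Finset.smul_sum]
    refine Finset.sum_congr rfl fun g _ => ?_
    have hu : ∃ i0 : Fin (m + 1), ∀ i : Fin (m + 1), ((prd p a = none ∧ i.val = 0) ∨
        ∃ b, prd p a = some b ∧ i.val = (g b).val + 1) ↔ i0 = i := by
      cases hpr : prd p a with
      | none => exact ⟨⟨0, by omega⟩, fun i => ⟨(by
          rintro (⟨-, h⟩ | ⟨b, h, -⟩)
          · exact Fin.ext h.symm
          · cases h), fun h => .inl ⟨rfl, by rw [← h]⟩⟩⟩
      | some b => exact ⟨(g b).succ, fun i => ⟨(by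
          rintro (⟨h, -⟩ | ⟨b, h, h'⟩)
          · cases h
          · cases h
            exact Fin.ext h'.symm), fun h => .inr ⟨b, rfl, by rw [← h]; simp⟩⟩⟩
    obtain ⟨i0, hi0⟩ := hu
    simp only [hi0]
    by_cases hg : IsShuffle (blk p a) g
    · simp only [hg, true_and, Finset.sum_ite_eq, Finset.mem_univ, if_true]
      rw [map_zsmul, pull_comp, smul_smul]
    · simp [hg]
  have htot : shuffleSum M (m + 1) p (hochschild M m x) =
      ∑ i : Fin (m + 2), ∑ f : Equiv.Perm (Fin (m + 1)), (if IsShuffle p f then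
      ((-1 : ℤ) ^ (i : ℕ) * Equiv.Perm.sign f) • pull M (perm f ≫ coface m i) x else 0) := by
    rw [shuffleSum_apply, Finset.sum_comm]
    refine Finset.sum_congr rfl fun f _ => ?_
    split_ifs with h
    · rw [hochschild_apply, map_sum, Finset.smul_sum]
      refine Finset.sum_congr rfl fun i _ => ?_
      rw [map_zsmul, pull_comp, smul_smul, mul_comm]
    · simp
  rw [htot, Fin.sum_univ_castSucc]
  simp only [Fin.val_castSucc, Fin.val_last]
  rw [hlast, Finset.sum_congr rfl (fun i _ => hterm i), hmain, ← Finset.sum_add_distrib]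
  refine Finset.sum_eq_zero fun a _ => ?_
  by_cases hb : 0 < blk p a ∧ blk p a < m
  · rw [hx _ hb.1 hb.2]
    simp
  · have ha := a.isLt
    have hprd : prd p a = none := by
      simp only [prd, dite_eq_left_iff, reduceCtorEq, imp_false, not_not]
      simp only [blk] at hb
      split_ifs at hb <;> omega
    have hlst : a.val + 1 = p ∨ a.val = m := by
      simp only [blk] at hb
      split_ifs at hb <;> omega
    rw [hprd, if_pos hlst, add_neg_cancel]

theorem hochschild_mem (M : Comm1Mod k) (m : ℕ) (x : M.obj (op (fin m)))
    (hx : x ∈ harrison M m) : hochschild M m x ∈ harrison M (m + 1) := by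
  rw [mem_harrison]
  exact fun p hp hpm => shuffleSum_hochschild M m x hx p hp hpm


theorem harrison_map {M N : Comm1Mod k} (φ : M ⟶ N) {m : ℕ} (x : M.obj (op (fin m)))
    (hx : x ∈ harrison M m) : (φ.app (op (fin m))).hom x ∈ harrison N m := by
  rw [mem_harrison] at hx ⊢
  intro p hp hpm
  have h := congrArg (φ.app (op (fin m))).hom (hx p hp hpm)
  rw [map_zero] at h
  rw [← h, shuffleSum_apply, shuffleSum_apply, map_sum]
  refine Finset.sum_congr rfl fun σ _ => ?_
  split_ifs
  · rw [map_zsmul, pull_natural]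
  · rw [map_zero]

/-- The derivation complex of a single module, placed in degrees `0, 1, 2, …`: in degree `m - 1`
(`m ≥ 1`) the values of a derivation on the generator of arity `m`. -/
noncomputable def harrisonComplex (M : Comm1Mod k) : CochainComplex (ModuleCat.{u} k) ℕ :=
  CochainComplex.of (fun j => ModuleCat.of k (harrison M (j + 1)))
    (fun j => ModuleCat.ofHom
      ((hochschild M (j + 1)).restrict (fun x hx => hochschild_mem M (j + 1) x hx)))
    (fun j => by
      ext x
      exact hochschild_sq M (j + 1) x.1)

/-- The derivation complex as a functor of the module. -/
noncomputable def harrisonFunctor (k : Type u) [Field k] :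
    Comm1Mod k ⥤ CochainComplex (ModuleCat.{u} k) ℕ where
  obj M := harrisonComplex M
  map {M N} φ := CochainComplex.ofHom
    (fun j => ModuleCat.ofHom
      ((φ.app (op (fin (j + 1)))).hom.restrict (fun x hx => harrison_map φ x hx)))
    (fun j => by
      simp only [harrisonComplex, CochainComplex.of_d]
      ext x
      change hochschild N (j + 1) ((φ.app _).hom x.1) = (φ.app _).hom (hochschild M (j + 1) x.1)
      rw [hochschild_apply, hochschild_apply, map_sum]
      exact Finset.sum_congr rfl fun i _ => by rw [map_zsmul, pull_natural])
  map_id M := by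
    ext j x
    rfl
  map_comp φ ψ := by
    ext j x
    rfl

instance harrisonFunctor_additive : (harrisonFunctor k).Additive where
  map_add {M N f g} := by
    ext j : 1
    rw [HomologicalComplex.add_f_apply]
    rfl

/-- Total degree and signs for the total complex of a bicomplex whose first degree is in `ℤ` and
whose second degree is in `ℕ`: the differential is `d₁ + (-1)^p d₂` in bidegree `(p, q)`. -/
instance totalShape :
    TotalComplexShape (ComplexShape.up ℤ) (ComplexShape.up ℕ) (ComplexShape.up ℤ) where
  π pq := pq.1 + pq.2
  ε₁ _ := 1
  ε₂ pq := pq.1.negOnePow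
  rel₁ {i₁ i₁'} h i₂ := by
    simp only [ComplexShape.up_Rel] at h ⊢
    omega
  rel₂ i₁ {i₂ i₂'} h := by
    simp only [ComplexShape.up_Rel] at h ⊢
    omega
  ε₂_ε₁ {i₁ i₁' i₂ i₂'} h _ := by
    simp only [ComplexShape.up_Rel] at h
    subst h
    simp [Int.negOnePow_succ]

/-- The derivation complex `H(M)` of a complex `M` of modules: the total complex (with direct sums) of
the bicomplex with entries `{x ∈ M^p([q + 1]) : x vanishes on shuffles}`. -/
noncomputable def derivationComplex (M : CochainComplex (Comm1Mod k) ℤ) :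
    CochainComplex (ModuleCat.{u} k) ℤ :=
  HomologicalComplex₂.total (((harrisonFunctor k).mapHomologicalComplex (ComplexShape.up ℤ)).obj M)
    (ComplexShape.up ℤ)


open MvPolynomial in
theorem isWeightedHomogeneous_aeval {σ τ A B : Type*} [AddCommMonoid A] [AddCommMonoid B]
    {w : σ → A} {v : τ → B} (L : A →+ B) (φ : σ → MvPolynomial τ k)
    (h : ∀ s, IsWeightedHomogeneous v (φ s) (L (w s))) {p : MvPolynomial σ k} {a : A}
    (hp : IsWeightedHomogeneous w p a) : IsWeightedHomogeneous v (aeval φ p) (L a) := by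
  rw [aeval_def, eval₂_eq]
  refine IsWeightedHomogeneous.sum _ _ _ fun d hd => ?_
  have hw : L a = ∑ i ∈ d.support, d i • L (w i) := by
    rw [← hp (mem_support_iff.1 hd), Finsupp.weight_apply, Finsupp.sum, map_sum]
    simp
  rw [hw]
  exact IsWeightedHomogeneous.C_mul
    (IsWeightedHomogeneous.prod _ _ _ fun i _ => (h i).pow _) _

/-- Let `V` have the basis `e_1, …, e_n`. The symmetric coalgebra `SV` (in characteristic zero) is the
polynomial algebra with the coproduct for which `V` is primitive, so that `⊗_{x ∈ X} SV` is the
polynomial algebra in the variables `e_i` of the `x`-th factor, indexed by `(x, i) ∈ X × [n]`. This is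
the multidegree of these variables: `e_i` has the degree `(0, …, 1, …, 0)` in every factor. -/
def gr (n : ℕ) (X : FinPart) : X.carrier × Fin n → (Fin n → ℕ) := fun xi => Pi.single xi.2 1

/-- The component of multidegree `(1, 1, …, 1)` of `⊗_{x ∈ X} SV`. -/
noncomputable def multilinear (k : Type u) [Field k] (n : ℕ) (X : FinPart) :
    Submodule k (MvPolynomial (X.carrier × Fin n) k) :=
  MvPolynomial.weightedHomogeneousSubmodule k (gr n X) (fun _ => 1)

open Classical in
/-- The map `⊗_{y ∈ Y} SV → ⊗_{x ∈ X} SV` induced by a partial map `f : X ⇀ Y`: it applies to the `y`-th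
factor the iterated coproduct with values in the factors `x ∈ f⁻¹(y)` (the counit, if `f⁻¹(y)` is
empty), and puts `1` into the factors at which `f` is undefined. As the coproduct and the counit
are maps of algebras, this is the map of algebras that is determined by
`e_i` in the factor `y` `↦` the sum of the `e_i` in the factors `x ∈ f⁻¹(y)`. -/
noncomputable def coprod (k : Type u) [Field k] (n : ℕ) {X Y : FinPart} (f : X ⟶ Y) :
    MvPolynomial (Y.carrier × Fin n) k →ₐ[k] MvPolynomial (X.carrier × Fin n) k :=
  MvPolynomial.aeval fun yi => ∑ x : X.carrier with f.toFun x = some yi.1, MvPolynomial.X (x, yi.2)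

theorem coprod_mem (n : ℕ) {X Y : FinPart} (f : X ⟶ Y) :
    ∀ p ∈ multilinear k n Y, coprod k n f p ∈ multilinear k n X := by
  classical
  intro p hp
  have h : ∀ yi : Y.carrier × Fin n, MvPolynomial.IsWeightedHomogeneous (gr n X)
      (∑ x : X.carrier with f.toFun x = some yi.1,
        (MvPolynomial.X (x, yi.2) : MvPolynomial (X.carrier × Fin n) k))
      (AddMonoidHom.id _ (gr n Y yi)) := fun yi =>
    MvPolynomial.IsWeightedHomogeneous.sum _ _ _ fun x _ =>
      MvPolynomial.isWeightedHomogeneous_X k (gr n X) (x, yi.2)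
  have hp' : MvPolynomial.IsWeightedHomogeneous (gr n Y) p (fun _ => 1) := hp
  have := isWeightedHomogeneous_aeval (AddMonoidHom.id _) _ h hp'
  rw [multilinear, MvPolynomial.mem_weightedHomogeneousSubmodule, coprod]
  exact this

theorem coprod_id (n : ℕ) (X : FinPart) : coprod k n (𝟙 X) = AlgHom.id k _ := by
  refine MvPolynomial.algHom_ext fun yi => ?_
  classical
  simp only [coprod, MvPolynomial.aeval_X, AlgHom.id_apply]
  rw [Finset.sum_filter, Finset.sum_eq_single yi.1]
  · exact (if_pos rfl).trans rfl
  · intro x _ hx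
    rw [if_neg]
    simpa using hx
  · simp

theorem coprod_comp (n : ℕ) {X Y Z : FinPart} (f : X ⟶ Y) (g : Y ⟶ Z) :
    coprod k n (f ≫ g) = (coprod k n f).comp (coprod k n g) := by
  classical
  refine MvPolynomial.algHom_ext fun zi => ?_
  simp only [coprod, AlgHom.comp_apply, MvPolynomial.aeval_X, map_sum]
  rw [← Finset.sum_biUnion]
  · refine Finset.sum_congr ?_ fun _ _ => rfl
    ext x
    simp [Option.bind_eq_some_iff, and_comm]
  · intro y _ y' _ hne
    rw [Function.onFun, Finset.disjoint_left]
    intro x hx hx'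
    simp only [Finset.mem_filter, Finset.mem_univ, true_and] at hx hx'
    exact hne (Option.some_injective _ (hx.symm.trans hx'))

theorem rename_mem (n : ℕ) (X : FinPart) (σ : Equiv.Perm (Fin n)) :
    ∀ p ∈ multilinear k n X,
      MvPolynomial.rename (Prod.map id σ) p ∈ multilinear k n X := fun p hp => by
  have := isWeightedHomogeneous_aeval (v := gr n X)
    (⟨⟨fun c i => c (σ.symm i), rfl⟩, fun _ _ => rfl⟩ : (Fin n → ℕ) →+ (Fin n → ℕ))
    (fun xi => MvPolynomial.X (Prod.map id σ xi)) (fun xi => by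
      have h := MvPolynomial.isWeightedHomogeneous_X k (gr n X) (Prod.map id σ xi)
      convert h using 1
      ext i
      simp [gr, Pi.single_apply, Equiv.symm_apply_eq]) hp
  rw [multilinear, MvPolynomial.mem_weightedHomogeneousSubmodule]
  have e : MvPolynomial.rename (R := k) (Prod.map id σ) =
      MvPolynomial.aeval fun xi : X.carrier × Fin n => MvPolynomial.X (Prod.map id σ xi) :=
    MvPolynomial.algHom_ext fun _ => by simp
  rw [e]
  exact this

/-- The action of `S_n` on `J_n(X)` by permutations of the `e_i`. -/
noncomputable def Jrep (k : Type u) [Field k] (n : ℕ) (X : FinPart) :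
    Representation k (Equiv.Perm (Fin n)) (multilinear k n X) where
  toFun σ := (MvPolynomial.rename (Prod.map id σ)).toLinearMap.restrict (rename_mem n X σ)
  map_one' := by
    ext p
    simp
  map_mul' σ τ := by
    refine LinearMap.ext fun p => Subtype.ext ?_
    change MvPolynomial.rename _ p.1 = MvPolynomial.rename _ (MvPolynomial.rename _ p.1)
    rw [MvPolynomial.rename_rename]
    rfl

/-- The module `J_n` together with its action of `S_n`. -/
noncomputable def Jn (k : Type u) [Field k] (n : ℕ) : FinPartᵒᵖ ⥤ Rep.{u} k (Equiv.Perm (Fin n)) where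
  obj X := Rep.of (Jrep k n X.unop)
  map {Y X} f := Rep.ofHom ⟨(coprod k n f.unop).toLinearMap.restrict (coprod_mem n f.unop), by
    intro σ
    ext p : 1
    apply Subtype.ext
    change coprod k n f.unop (MvPolynomial.rename _ p.1) =
      MvPolynomial.rename _ (coprod k n f.unop p.1)
    rw [← AlgHom.comp_apply, ← AlgHom.comp_apply]
    congr 1
    refine MvPolynomial.algHom_ext fun yi => ?_
    simp [coprod]⟩
  map_id X := by
    ext p
    refine congrArg (MvPolynomial.coeff _) ?_
    change coprod k n (𝟙 _) p.1 = p.1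
    rw [coprod_id]
    rfl
  map_comp f g := by
    ext p
    refine congrArg (MvPolynomial.coeff _) ?_
    change coprod k n (g.unop ≫ f.unop) p.1 = coprod k n g.unop (coprod k n f.unop p.1)
    rw [coprod_comp]
    rfl

open MonoidalCategory in
/-- The functor `P ↦ J(P)`, where `J(P)(X) = (J_n(X) ⊗ P)^{S_n}` with the diagonal action. -/
noncomputable def J (k : Type u) [Field k] (n : ℕ) : Rep.{u} k (Equiv.Perm (Fin n)) ⥤ Comm1Mod k :=
  (Jn k n ⋙ curriedTensor _ ⋙
    (Functor.whiskeringRight _ _ _).obj (Rep.invariantsFunctor k _)).flip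

open MonoidalCategory in
instance J_additive (n : ℕ) : (J k n).Additive where
  map_add {P Q f g} := by
    ext X : 2
    change (Rep.invariantsFunctor k _).map ((Jn k n).obj X ◁ (f + g)) =
      (Rep.invariantsFunctor k _).map ((Jn k n).obj X ◁ f) +
      (Rep.invariantsFunctor k _).map ((Jn k n).obj X ◁ g)
    rw [MonoidalPreadditive.whiskerLeft_add, Functor.map_add]

end CommOne

/-!
The monomials of multidegree `(1, …, 1)` in `⊗_{x ∈ X} SV` correspond to the maps `[n] → X`, so
`J_n(X) ⊗ P` is the space of functions `Fun(Xⁿ, P)`, on which partial maps act by pullback and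
extension by zero (`funMod`). In characteristic zero, averaging over `S_n` makes `J(P)` a retract
of this module, naturally in `P` (`toFunMod`, `ofFunMod`). It therefore suffices to contract the
derivation complex of `Fun(Xⁿ, P)`, naturally in `P`.

A map `[n] → [m]` is a word of length `m`, whose letters are the fibres. Let `n ≥ 1` and fix `j₀ ∈
[n]`. Functions that vanish on signed shuffles are like Lie elements that are linear in one
letter: such a function is determined by its values on the words whose first letter contains `j₀`
(`eq_zero_of_mem_harrison`), and these values are arbitrary (`extend`, which rests on
`signedShuffle_lieExtend`, the fact that iterated brackets vanish on shuffles). In terms of these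
values the differential has no first term, because the first letter is not empty. What remains is
a cosimplicial object with an extra degeneracy, namely the pullback along the map that splits off
`j₀` from the first letter as a letter of its own (`splitPull`). This gives the contracting
homotopy `contract`. In the lowest degree the homotopy identity involves the term in which the
last letter of the word `{j₀}, [n] ∖ {j₀}` is empty. It occurs exactly if `n = 1`, and then the
differential out of degree zero is zero and the complex retracts to its part `P` of degree zero.

For `n = 0` the module is constant. The number of shuffles of two letters with other letters,
counted with signs, is positive (`exists_signedShuffle_pair_eq`), so that in characteristic zero
the complex is concentrated in the degrees `0` and `1`, where its differential is the identity of
`P`.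

As the homotopies are natural in `P`, they assemble, up to signs, to a homotopy on the total
complex (`ColumnRetraction.homotopyEquiv`).
-/

/-! ### Signed shuffles of words -/

namespace CommOne

section Words

variable {α V : Type*} [AddCommGroup V]

/-- The signed sum of the values of `H` on all shuffles of two words, where every transposition of
two letters contributes the sign `-1`. -/
def signedShuffle : List α → List α → (List α → V) → V
  | [], v, H => H v
  | a :: u, [], H => H (a :: u)
  | a :: u, b :: v, H => signedShuffle u (b :: v) (fun w => H (a :: w)) +
      (-1 : ℤ) ^ (u.length + 1) • signedShuffle (a :: u) v (fun w => H (b :: w))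
termination_by u v => u.length + v.length

@[simp] theorem signedShuffle_nil_left (v : List α) (H : List α → V) :
    signedShuffle [] v H = H v := by
  rw [signedShuffle]

@[simp] theorem signedShuffle_nil_right (u : List α) (H : List α → V) :
    signedShuffle u [] H = H u := by
  cases u <;> rw [signedShuffle]

theorem signedShuffle_cons_cons (a b : α) (u v : List α) (H : List α → V) :
    signedShuffle (a :: u) (b :: v) H = signedShuffle u (b :: v) (fun w => H (a :: w)) +
      (-1 : ℤ) ^ (u.length + 1) • signedShuffle (a :: u) v (fun w => H (b :: w)) := by
  rw [signedShuffle]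

theorem signedShuffle_zero (u v : List α) : signedShuffle u v (fun _ => (0 : V)) = 0 := by
  induction u generalizing v with
  | nil => simp
  | cons a u ihu =>
    induction v with
    | nil => simp
    | cons b v ihv => rw [signedShuffle_cons_cons, ihu, ihv]; simp

theorem signedShuffle_add_zsmul (u v : List α) (H H' : List α → V) (c : ℤ) :
    signedShuffle u v (fun w => H w + c • H' w) =
      signedShuffle u v H + c • signedShuffle u v H' := by
  induction u generalizing v H H' with
  | nil => simp
  | cons a u ihu =>
    induction v generalizing H H' with
    | nil => simp
    | cons b v ihv =>
      simp only [signedShuffle_cons_cons]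
      rw [ihu, ihv]
      module

theorem signedShuffle_congr {u v : List α} {H H' : List α → V}
    (h : ∀ w : List α, w.length = u.length + v.length → H w = H' w) :
    signedShuffle u v H = signedShuffle u v H' := by
  induction u generalizing v H H' with
  | nil => simpa using h v (by simp)
  | cons a u ihu =>
    induction v generalizing H H' with
    | nil => simpa using h (a :: u) (by simp)
    | cons b v ihv =>
      simp only [signedShuffle_cons_cons]
      rw [ihu (H' := fun w => H' (a :: w)) fun w hw => h _ (by simp at hw ⊢; omega),
        ihv (H' := fun w => H' (b :: w)) fun w hw => h _ (by simp at hw ⊢; omega)]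

/-- The recursion for signed shuffles by the last letter. -/
theorem signedShuffle_concat_concat (b c : α) (u v : List α) (H : List α → V) :
    signedShuffle (u ++ [b]) (v ++ [c]) H =
      signedShuffle (u ++ [b]) v (fun w => H (w ++ [c])) +
        (-1 : ℤ) ^ (v.length + 1) • signedShuffle u (v ++ [c]) (fun w => H (w ++ [b])) := by
  induction u generalizing v H with
  | nil =>
    induction v generalizing H with
    | nil => simp [signedShuffle_cons_cons]
    | cons d v ihv =>
      have := ihv (fun w => H (d :: w))
      simp only [List.nil_append, List.cons_append, signedShuffle_cons_cons,
        signedShuffle_nil_left] at this ⊢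
      rw [this]
      simp only [List.length_nil, List.length_cons, pow_succ]
      module
  | cons a u ihu =>
    induction v generalizing H with
    | nil =>
      have := ihu [] (fun w => H (a :: w))
      simp only [List.nil_append, List.cons_append, signedShuffle_cons_cons,
        signedShuffle_nil_right] at this ⊢
      rw [this]
      simp only [List.length_nil, List.length_append, List.length_cons, pow_succ]
      module
    | cons d v ihv =>
      have h1 := ihu (d :: v) (fun w => H (a :: w))
      have h2 := ihv (fun w => H (d :: w))
      simp only [List.cons_append, signedShuffle_cons_cons] at h1 h2 ⊢
      rw [h1, h2]
      simp only [List.length_nil, List.length_append, List.length_cons, pow_succ]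
      module

/-- If `H` vanishes on the words with the letter `a` at an early place, then the only shuffle of
`u` and `a v` that contributes is `u a v`. -/
theorem signedShuffle_eq_of_forall_eq_zero (a : α) (u v : List α) (H : List α → V)
    (h : ∀ u' v' : List α, u'.length < u.length → H (u' ++ a :: v') = 0) :
    signedShuffle u (a :: v) H = H (u ++ a :: v) := by
  induction u generalizing H with
  | nil => simp
  | cons b u ih =>
    have h0 : (fun w => H (a :: w)) = fun _ => 0 := funext fun w => h [] w (by simp)
    rw [signedShuffle_cons_cons, h0, signedShuffle_zero, smul_zero, add_zero, ih]
    · rfl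
    · exact fun u' v' hu => h (b :: u') v' (by simpa using hu)

variable (D : α → Prop) [DecidablePred D]

/-- Let `D` single out some letters. This is the function on words that extends the values of `G` on
the words `a₁ a₂ … aₘ` in which only `a₁` satisfies `D`, and vanishes on signed shuffles: it is dual
to the passage from such a word to the iterated bracket `[…[[a₁, a₂], a₃], …, aₘ]`, where the
letters are odd. -/
def lieExtend (G : List α → V) : List α → V
  | [] => 0
  | [a] => if D a then G [a] else 0
  | a :: b :: w =>
      lieExtend (fun x => G (x ++ [(b :: w).getLast (List.cons_ne_nil b w)]))
        (a :: (b :: w).dropLast) +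
      (-1 : ℤ) ^ w.length • lieExtend (fun x => G (x ++ [a])) (b :: w)
termination_by w => w.length

@[simp] theorem lieExtend_nil (G : List α → V) : lieExtend D G [] = 0 := by
  rw [lieExtend]

@[simp] theorem lieExtend_singleton (G : List α → V) (a : α) :
    lieExtend D G [a] = if D a then G [a] else 0 := by
  rw [lieExtend]

theorem lieExtend_cons_concat (G : List α → V) (a b : α) (w : List α) :
    lieExtend D G (a :: (w ++ [b])) = lieExtend D (fun x => G (x ++ [b])) (a :: w) +
      (-1 : ℤ) ^ w.length • lieExtend D (fun x => G (x ++ [a])) (w ++ [b]) := by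
  have key : ∀ (c : α) (x : List α), w ++ [b] = c :: x → lieExtend D G (a :: (c :: x)) =
      lieExtend D (fun x => G (x ++ [b])) (a :: w) +
        (-1 : ℤ) ^ x.length • lieExtend D (fun x => G (x ++ [a])) (c :: x) := by
    intro c x h
    rw [lieExtend]
    simp only [← h, List.getLast_append_singleton, List.dropLast_concat]
  cases w with
  | nil => exact key b [] rfl
  | cons c w => simpa using key c (w ++ [b]) rfl

theorem exists_eq_cons_concat {w : List α} (h : 2 ≤ w.length) :
    ∃ a v b, w = a :: (v ++ [b]) := by
  obtain _ | ⟨a, w⟩ := w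
  · simp at h
  · obtain rfl | ⟨v, b, rfl⟩ := List.eq_nil_or_concat w
    · simp at h
    · exact ⟨a, v, b, by simp⟩

/-- Induction on words by removal of the first or of the last letter. -/
theorem word_induction {C : List α → Prop} (nil : C []) (one : ∀ a, C [a])
    (step : ∀ a w b, C (a :: w) → C (w ++ [b]) → C (a :: (w ++ [b]))) (w : List α) : C w := by
  induction hl : w.length using Nat.strong_induction_on generalizing w with
  | _ l ih =>
    by_cases h2 : 2 ≤ w.length
    · obtain ⟨a, v, b, rfl⟩ := exists_eq_cons_concat h2
      exact step a v b (ih _ (by simp at hl ⊢; omega) _ rfl) (ih _ (by simp at hl ⊢; omega) _ rfl)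
    · match w with
      | [] => exact nil
      | [a] => exact one a
      | a :: b :: v => simp at h2

theorem lieExtend_add (G G' : List α → V) (w : List α) :
    lieExtend D (fun x => G x + G' x) w = lieExtend D G w + lieExtend D G' w := by
  induction w using word_induction generalizing G G' with
  | nil => simp
  | one a => simp only [lieExtend_singleton]; split_ifs <;> simp
  | step a w b h1 h2 =>
    simp only [lieExtend_cons_concat, h1, h2]
    module

theorem map_lieExtend {V' F : Type*} [AddCommGroup V'] [FunLike F V V'] [AddMonoidHomClass F V V']
    (g : F) (G : List α → V) (w : List α) :
    g (lieExtend D G w) = lieExtend D (fun x => g (G x)) w := by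
  induction w using word_induction generalizing G with
  | nil => simp
  | one a => simp only [lieExtend_singleton]; split_ifs <;> simp
  | step a w b h1 h2 => simp only [lieExtend_cons_concat, h1, h2, map_add, map_zsmul]

theorem lieExtend_eq_zero (G : List α → V) (w : List α) (h : ∀ a ∈ w, ¬ D a) :
    lieExtend D G w = 0 := by
  induction w using word_induction generalizing G with
  | nil => simp
  | one a => simpa using fun ha => absurd ha (h a (by simp))
  | step a w b h1 h2 =>
    rw [lieExtend_cons_concat, h1 _ fun x hx => h x (by simp at hx ⊢; tauto),
      h2 _ fun x hx => h x (by simp at hx ⊢; tauto)]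
    simp

theorem lieExtend_cons (G : List α → V) (a : α) (w : List α) (ha : D a) (h : ∀ b ∈ w, ¬ D b) :
    lieExtend D G (a :: w) = G (a :: w) := by
  induction w using List.reverseRecOn generalizing G with
  | nil => simp [ha]
  | append_singleton w b ih =>
    rw [lieExtend_cons_concat, ih _ fun x hx => h x (by simp [hx]), lieExtend_eq_zero D _ _ h]
    simp

/-- The function `lieExtend D G` vanishes on signed shuffles of nonempty words. Splitting off the last
or the first letter from a shuffle of `u` and `v` leaves a shuffle of smaller words, so by induction
the only contributions come from the words `u` and `v` of length one, and these cancel. -/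
theorem signedShuffle_lieExtend (G : List α → V) (u v : List α) (hu : u ≠ []) (hv : v ≠ []) :
    signedShuffle u v (lieExtend D G) = 0 := by
  induction hl : u.length + v.length using Nat.strong_induction_on generalizing u v G with
  | _ l ih =>
    let T₁ : List α → V := fun w =>
      w.getLast?.elim 0 fun c => lieExtend D (fun x => G (x ++ [c])) w.dropLast
    let T₂ : List α → V := fun w =>
      w.head?.elim 0 fun c => lieExtend D (fun x => G (x ++ [c])) w.tail
    have hT₁ : ∀ c, (fun w => T₁ (w ++ [c])) = lieExtend D (fun x => G (x ++ [c])) := fun c => by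
      ext w
      simp [T₁]
    have hT₂ : ∀ c, (fun w => T₂ (c :: w)) = lieExtend D (fun x => G (x ++ [c])) := fun c => by
      ext w
      simp [T₂]
    have hlu := List.length_pos_iff.2 hu
    have hlv := List.length_pos_iff.2 hv
    have hT : signedShuffle u v (lieExtend D G) =
        signedShuffle u v T₁ + (-1 : ℤ) ^ l • signedShuffle u v T₂ := by
      rw [← signedShuffle_add_zsmul]
      refine signedShuffle_congr fun w hw => ?_
      obtain ⟨a, x, b, rfl⟩ := exists_eq_cons_concat (w := w) (by omega)
      have e : l = x.length + 2 := by simp at hw; omega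
      rw [lieExtend_cons_concat, ← congrFun (hT₁ b), ← congrFun (hT₂ a), e, pow_add]
      simp
    have h₂ : ∀ b c u' v', u = b :: u' → v = c :: v' → signedShuffle u v T₂ =
        (if u' = [] then lieExtend D (fun x => G (x ++ [b])) v else 0) +
        (-1 : ℤ) ^ u.length • (if v' = [] then lieExtend D (fun x => G (x ++ [c])) u else 0) := by
      rintro b c u' v' rfl rfl
      rw [signedShuffle_cons_cons, hT₂, hT₂]
      congr 1
      · split_ifs with h
        · simp [h]
        · exact ih _ (by simp at hl ⊢; omega) _ _ _ h hv rfl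
      · congr 1
        split_ifs with h
        · simp [h]
        · exact ih _ (by simp at hl ⊢; omega) _ _ _ hu h rfl
    have h₁ : ∀ b c u' v', u = u' ++ [b] → v = v' ++ [c] → signedShuffle u v T₁ =
        (if v' = [] then lieExtend D (fun x => G (x ++ [c])) u else 0) +
        (-1 : ℤ) ^ v.length • (if u' = [] then lieExtend D (fun x => G (x ++ [b])) v else 0) := by
      rintro b c u' v' rfl rfl
      rw [signedShuffle_concat_concat, hT₁, hT₁, List.length_append, List.length_singleton]
      congr 1
      · split_ifs with h
        · simp [h]
        · exact ih _ (by simp at hl ⊢; omega) _ _ _ hu h rfl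
      · congr 1
        split_ifs with h
        · simp [h]
        · exact ih _ (by simp at hl ⊢; omega) _ _ _ h hv rfl
    -- A nonempty word is a single letter exactly if nothing is left without its first letter, and
    -- exactly if nothing is left without its last letter.
    have key : ∀ w : List α, w ≠ [] → (∃ b, w = [b]) ∨
        ∃ b w' b' w'', w = b :: w' ∧ w = w'' ++ [b'] ∧ w' ≠ [] ∧ w'' ≠ [] := by
      intro w hw
      by_cases h2 : 2 ≤ w.length
      · obtain ⟨a, x, b, rfl⟩ := exists_eq_cons_concat h2
        exact Or.inr ⟨a, x ++ [b], b, a :: x, rfl, rfl, by simp, by simp⟩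
      · match w with
        | [] => exact absurd rfl hw
        | [a] => exact Or.inl ⟨a, rfl⟩
        | a :: b :: v => simp at h2
    rw [hT, ← hl, pow_add]
    obtain ⟨b, rfl⟩ | ⟨b, u', b', u'', e₁, e₂, hu', hu''⟩ := key u hu
    · obtain ⟨c, rfl⟩ | ⟨c, v', c', v'', e₃, e₄, hv', hv''⟩ := key v hv
      · rw [h₁ b c [] [] rfl rfl, h₂ b c [] [] rfl rfl]
        simp only [lieExtend_singleton, if_true, List.length_singleton, pow_one]
        module
      · rw [h₁ b c' [] v'' rfl e₄, h₂ b c [] v' rfl e₃]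
        simp [hv', hv'']
    · obtain ⟨c, rfl⟩ | ⟨c, v', c', v'', e₃, e₄, hv', hv''⟩ := key v hv
      · rw [h₁ b' c u'' [] e₂ rfl, h₂ b c u' [] e₁ rfl]
        simp [hu', hu'', smul_smul, ← pow_add, (Even.add_self _).neg_one_pow]
      · rw [h₁ b' c' u'' v'' e₂ e₄, h₂ b c u' v' e₁ e₃]
        simp [hu', hu'', hv', hv'']

/-- The number of shuffles of two letters with any other letters, counted with signs, is positive. -/
theorem exists_signedShuffle_pair_eq (a b : α) (v : List α) :
    ∃ c : ℕ, ∀ x : V, signedShuffle [a, b] v (fun _ => x) = (c + 1) • x := by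
  have h1 : ∀ v : List α, ∃ c : ℕ, (c = 0 ∨ c = 1) ∧
      ∀ x : V, signedShuffle [b] v (fun _ => x) = c • x := by
    intro v
    induction v with
    | nil => exact ⟨1, by simp⟩
    | cons d v ih =>
      obtain ⟨c, hc | hc, h⟩ := ih
      · exact ⟨1, by simp, fun x => by rw [signedShuffle_cons_cons, h]; simp [hc]⟩
      · exact ⟨0, by simp, fun x => by rw [signedShuffle_cons_cons, h]; simp [hc]⟩
  induction v with
  | nil => exact ⟨0, by simp⟩
  | cons d v ih =>
    obtain ⟨c, h⟩ := ih
    obtain ⟨c', -, h'⟩ := h1 (d :: v)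
    refine ⟨c' + c, fun x => ?_⟩
    rw [signedShuffle_cons_cons, h, h']
    simp [add_smul, add_assoc]

end Words

/-! ### Shuffle permutations and modules of functions -/

open FinPart

section Shuffles

variable {α V : Type*} [AddCommGroup V]

theorem isShuffle_ins_zero_iff {m p : ℕ} (hp : 0 < p) (a : Fin (m + 1)) (g : Equiv.Perm (Fin m)) :
    IsShuffle p (ins a 0 g) ↔ (a.val = 0 ∨ a.val = p) ∧ IsShuffle (blk p a) g := by
  have h := shuffle_ins_iff hp a 0 g
  have hmix : ¬ Mixed p ((0 : Fin (m + 1)) : ℕ) (ins a 0 g) := by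
    rintro ⟨b, c, hb, -⟩
    simp at hb
  have hprd : prd p a = none ↔ a.val = 0 ∨ a.val = p := by
    simp [prd]
    tauto
  rw [and_iff_left hmix] at h
  rw [h, ← hprd]
  simp [and_comm]

theorem isShuffle_zero_iff {m : ℕ} (σ : Equiv.Perm (Fin m)) : IsShuffle 0 σ ↔ σ = 1 := by
  constructor
  · intro h
    have hm : StrictMono σ := fun a b hab => h a b hab (Or.inr (Nat.zero_le _))
    have := Subsingleton.elim (hm.orderIsoOfSurjective σ σ.surjective) (OrderIso.refl (Fin m))
    ext a : 1
    exact congrArg (fun e : Fin m ≃o Fin m => e a) this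
  · rintro rfl a b hab -
    exact hab

theorem ofFn_comp_ins_inv {m : ℕ} (w : Fin (m + 1) → α) (a : Fin (m + 1)) (g : Equiv.Perm (Fin m)) :
    List.ofFn (w ∘ ⇑(ins a 0 g)⁻¹) = w a :: List.ofFn ((w ∘ a.succAbove) ∘ ⇑g⁻¹) := by
  rw [List.ofFn_succ]
  congr 1
  · simp only [Function.comp_apply]
    rw [Equiv.Perm.inv_eq_iff_eq.2 (ins_self a 0 g).symm]
  · congr 1
    ext i : 1
    simp only [Function.comp_apply]
    congr 1
    rw [Equiv.Perm.inv_eq_iff_eq, ins_succAbove]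
    simp

theorem take_ofFn_succAbove {m : ℕ} (w : Fin (m + 1) → α) (a : Fin (m + 1)) :
    (List.ofFn (w ∘ a.succAbove)).take a.val = (List.ofFn w).take a.val := by
  refine List.ext_getElem (by simp; omega) fun i h1 h2 => ?_
  have hi : i < a.val := by simp at h1; omega
  simp only [List.getElem_take, List.getElem_ofFn, Function.comp_apply, Fin.succAbove, Fin.lt_def,
    Fin.val_castSucc, hi, if_true]
  rfl

theorem drop_ofFn_succAbove {m : ℕ} (w : Fin (m + 1) → α) (a : Fin (m + 1)) :
    (List.ofFn (w ∘ a.succAbove)).drop a.val = (List.ofFn w).drop (a.val + 1) := by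
  refine List.ext_getElem (by simp) fun i h1 h2 => ?_
  simp only [List.getElem_drop, List.getElem_ofFn, Function.comp_apply, Fin.succAbove, Fin.lt_def,
    Fin.val_castSucc, not_lt.2 (Nat.le_add_right a.val i), if_false]
  congr 2
  simp
  omega

open Classical in
/-- The signed sum over shuffle permutations is the recursively defined sum over shuffles of words.
The label at the place `0` is the first one of one of the two blocks. -/
theorem sum_isShuffle {m p : ℕ} (hp : p ≤ m) (w : Fin m → α) (H : List α → V) :
    (∑ σ : Equiv.Perm (Fin m),
      if IsShuffle p σ then (Equiv.Perm.sign σ : ℤ) • H (List.ofFn (w ∘ ⇑σ⁻¹)) else 0) =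
    signedShuffle ((List.ofFn w).take p) ((List.ofFn w).drop p) H := by
  induction m generalizing p H with
  | zero =>
    obtain rfl : p = 0 := by omega
    simp [isShuffle_zero_iff]
  | succ m ih =>
    obtain _ | p := p
    · simp only [isShuffle_zero_iff, Finset.sum_ite_eq', Finset.mem_univ, if_true, inv_one,
        Equiv.Perm.coe_one, Function.comp_id, Equiv.Perm.sign_one, List.take_zero, List.drop_zero,
        signedShuffle_nil_left, Units.val_one, one_smul]
    have hsum : ∀ a : Fin (m + 1), (∑ g : Equiv.Perm (Fin m),
        if IsShuffle (p + 1) (ins a 0 g) then (Equiv.Perm.sign (ins a 0 g) : ℤ) •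
          H (List.ofFn (w ∘ ⇑(ins a 0 g)⁻¹)) else 0) =
        if a.val = 0 ∨ a.val = p + 1 then (-1 : ℤ) ^ a.val •
          signedShuffle ((List.ofFn (w ∘ a.succAbove)).take (blk (p + 1) a))
            ((List.ofFn (w ∘ a.succAbove)).drop (blk (p + 1) a)) (fun x => H (w a :: x)) else 0 := by
      intro a
      split_ifs with ha
      · rw [← ih (by have := a.isLt; simp only [blk]; split_ifs <;> omega), Finset.smul_sum]
        refine Finset.sum_congr rfl fun g _ => ?_
        simp only [isShuffle_ins_zero_iff (Nat.succ_pos p), ha, true_and, smul_ite, smul_zero,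
          ofFn_comp_ins_inv, sign_ins, smul_smul]
        simp
      · refine Finset.sum_eq_zero fun g _ => if_neg ?_
        rw [isShuffle_ins_zero_iff (Nat.succ_pos p)]
        exact fun h => ha h.1
    rw [sum_ins 0, Finset.sum_congr rfl fun a _ => hsum a]
    have hfirst : (List.ofFn w).take (p + 1) = w 0 :: (List.ofFn (w ∘ Fin.succ)).take p := by
      rw [List.ofFn_succ, List.take_succ_cons]
      rfl
    have hzero : signedShuffle ((List.ofFn (w ∘ (0 : Fin (m + 1)).succAbove)).take
        (blk (p + 1) (0 : Fin (m + 1))))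
        ((List.ofFn (w ∘ (0 : Fin (m + 1)).succAbove)).drop (blk (p + 1) (0 : Fin (m + 1))))
          (fun x => H (w 0 :: x)) =
        signedShuffle ((List.ofFn (w ∘ Fin.succ)).take p) ((List.ofFn w).drop (p + 1))
          (fun x => H (w 0 :: x)) := by
      rw [List.ofFn_succ (f := w), List.drop_succ_cons]
      simp [blk]
      rfl
    by_cases hpm : p = m
    · subst hpm
      rw [Finset.sum_eq_single 0]
      · rw [if_pos (by simp), hzero, hfirst]
        have : (List.ofFn w).drop (p + 1) = [] := by simp
        simp only [this, signedShuffle_nil_right, Fin.val_zero, pow_zero, one_smul]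
      · intro a _ ha
        have := a.isLt
        have := Fin.val_ne_zero_iff.2 ha
        rw [if_neg (by omega)]
      · simp
    · let q : Fin (m + 1) := ⟨p + 1, by omega⟩
      have hq : (List.ofFn w).drop (p + 1) = w q :: (List.ofFn w).drop (p + 2) := by
        rw [List.drop_eq_getElem_cons (by simp; omega)]
        simp [q]
      rw [Finset.sum_eq_add 0 q]
      · rw [if_pos (by simp), if_pos (by simp [q]), hzero, hfirst, hq, signedShuffle_cons_cons,
          ← hfirst]
        have hb : blk (p + 1) q = q.val := by simp [blk, q]
        rw [hb, take_ofFn_succAbove, drop_ofFn_succAbove]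
        have hl : ((List.ofFn (w ∘ Fin.succ)).take p).length = p := by simp; omega
        rw [hl]
        simp [q]
      · simp [q, Fin.ext_iff]
      · intro a _ ha
        rw [if_neg]
        rw [Ne, Ne, Fin.ext_iff, Fin.ext_iff] at ha
        simpa [q] using ha
      · simp
      · simp

end Shuffles

section Fun

/-- The composition of a family of points with a partial map, if it is everywhere defined. -/
def push {n : ℕ} {X Y : FinPart} (f : X ⟶ Y) (ψ : Fin n → X.carrier) : Option (Fin n → Y.carrier) :=
  if h : ∀ i, (f.toFun (ψ i)).isSome then some fun i => (f.toFun (ψ i)).get (h i) else none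

theorem push_eq_some_iff {n : ℕ} {X Y : FinPart} (f : X ⟶ Y)
    (ψ : Fin n → X.carrier) (φ : Fin n → Y.carrier) :
    push f ψ = some φ ↔ ∀ i, f.toFun (ψ i) = some (φ i) := by
  unfold push
  constructor
  · intro h
    split_ifs at h with hd
    simp only [Option.some.injEq] at h
    subst h
    simp
  · intro h
    rw [dif_pos fun i => by simp [h]]
    simp [h]

theorem push_of_eq_none {n : ℕ} {X Y : FinPart} (f : X ⟶ Y) (ψ : Fin n → X.carrier) (i : Fin n)
    (h : f.toFun (ψ i) = none) : push f ψ = none := by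
  unfold push
  rw [dif_neg]
  intro hd
  simpa [h] using hd i

theorem push_id {n : ℕ} {X : FinPart} (ψ : Fin n → X.carrier) : push (𝟙 X) ψ = some ψ := by
  simp [push_eq_some_iff]

theorem push_comp {n : ℕ} {X Y Z : FinPart} (f : X ⟶ Y) (g : Y ⟶ Z) (ψ : Fin n → X.carrier) :
    push (f ≫ g) ψ = (push f ψ).bind (push g) := by
  ext φ
  simp only [Option.bind_eq_some_iff, push_eq_some_iff, comp_toFun]
  constructor
  · intro h
    choose χ h1 h2 using h
    exact ⟨χ, h1, h2⟩
  · rintro ⟨χ, h1, h2⟩ i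
    exact ⟨χ i, h1 i, h2 i⟩

variable (k : Type u) [Field k] (n : ℕ) (P : Type u) [AddCommGroup P] [Module k P]

/-- The module `X ↦ Fun(Xⁿ, P)`. Functions are pulled back along partial maps and extended by zero. -/
def funMod : Comm1Mod k where
  obj X := ModuleCat.of k ((Fin n → X.unop.carrier) → P)
  map f := ModuleCat.ofHom
    { toFun := fun F ψ => (push f.unop ψ).elim 0 F
      map_add' := fun F G => by
        ext ψ
        cases h : push f.unop ψ <;> simp [h]
      map_smul' := fun c F => by
        ext ψ
        cases h : push f.unop ψ <;> simp [h] }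
  map_id X := by
    refine ModuleCat.hom_ext (LinearMap.ext fun F => funext fun ψ => ?_)
    change (push (𝟙 X.unop) ψ).elim 0 F = F ψ
    rw [push_id]
    rfl
  map_comp f g := by
    refine ModuleCat.hom_ext (LinearMap.ext fun F => funext fun ψ => ?_)
    change (push (g.unop ≫ f.unop) ψ).elim 0 F =
      (push g.unop ψ).elim 0 fun φ => (push f.unop φ).elim 0 F
    rw [push_comp]
    cases h : push g.unop ψ <;> rfl

variable {k P} {n : ℕ}

/-- The elements of `funMod k n P` as functions. -/
def vals {X : FinPart} : (funMod k n P).obj (op X) ≃ₗ[k] ((Fin n → X.carrier) → P) :=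
  LinearEquiv.refl k _

theorem vals_pull {X Y : FinPart} (f : X ⟶ Y) (F : (funMod k n P).obj (op Y))
    (ψ : Fin n → X.carrier) :
    vals (pull (funMod k n P) f F) ψ = (push f ψ).elim 0 (vals F) := rfl

/-- The word whose letters are the fibres of a map. -/
def word {m : ℕ} (ψ : Fin n → Fin m) : List (Set (Fin n)) := List.ofFn fun i => {j | ψ j = i}

@[simp] theorem length_word {m : ℕ} (ψ : Fin n → Fin m) : (word ψ).length = m := by simp [word]

theorem word_injective {m : ℕ} : Function.Injective (word : (Fin n → Fin m) → _) := by
  intro ψ φ h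
  have := List.ofFn_injective h
  ext j : 1
  have h1 : j ∈ {i | φ i = ψ j} := by
    rw [← congrFun this (ψ j)]
    rfl
  exact h1.symm

/-- A function of maps as a function of words, extended by zero. -/
noncomputable def onWords {m : ℕ} (F : (Fin n → Fin m) → P) : List (Set (Fin n)) → P :=
  Function.extend word F 0

@[simp] theorem onWords_word {m : ℕ} (F : (Fin n → Fin m) → P) (ψ : Fin n → Fin m) :
    onWords F (word ψ) = F ψ :=
  word_injective.extend_apply _ _ _

theorem word_comp_perm {m : ℕ} (σ : Equiv.Perm (Fin m)) (ψ : Fin n → Fin m) :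
    word (⇑σ ∘ ψ) = List.ofFn ((fun i => {j | ψ j = i}) ∘ ⇑σ⁻¹) := by
  unfold word
  congr 1
  ext i j
  simp only [Function.comp_apply, Set.mem_ofPred_eq]
  exact Equiv.Perm.eq_inv_iff_eq.symm

theorem vals_shuffleSum {m p : ℕ} (hp : p ≤ m) (F : (funMod k n P).obj (op (fin m)))
    (H : List (Set (Fin n)) → P) (hH : ∀ ψ : Fin n → Fin m, H (word ψ) = vals F ψ)
    (ψ : Fin n → Fin m) :
    vals (shuffleSum (funMod k n P) m p F) ψ =
      signedShuffle ((word ψ).take p) ((word ψ).drop p) H := by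
  classical
  rw [word, ← sum_isShuffle hp, shuffleSum_apply, map_sum, Finset.sum_apply]
  refine Finset.sum_congr rfl fun σ _ => ?_
  split_ifs
  · have h : push (perm σ) ψ = some (⇑σ ∘ ψ) := by
      rw [push_eq_some_iff]
      exact fun _ => rfl
    rw [← word_comp_perm, hH, map_zsmul, Pi.smul_apply, vals_pull, h]
    rfl
  · rw [map_zero, Pi.zero_apply]

theorem mem_harrison_funMod {m : ℕ} (F : (funMod k n P).obj (op (fin m)))
    (H : List (Set (Fin n)) → P) (hH : ∀ ψ : Fin n → Fin m, H (word ψ) = vals F ψ) :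
    F ∈ harrison (funMod k n P) m ↔ ∀ p, 0 < p → p < m → ∀ ψ : Fin n → Fin m,
      signedShuffle ((word ψ).take p) ((word ψ).drop p) H = 0 := by
  rw [mem_harrison]
  refine forall_congr' fun p => forall_congr' fun h0 => forall_congr' fun hm => ?_
  constructor
  · intro h ψ
    rw [← vals_shuffleSum hm.le F H hH, h, map_zero, Pi.zero_apply]
  · intro h
    refine vals.injective (funext fun ψ => ?_)
    rw [vals_shuffleSum hm.le F H hH, h ψ, map_zero, Pi.zero_apply]

end Fun

/-! ### The contraction for modules of functions -/

section Contraction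

variable {k : Type u} [Field k] {P : Type u} [AddCommGroup P] [Module k P] {n : ℕ}

theorem push_eq_none_iff {X Y : FinPart} (f : X ⟶ Y) (ψ : Fin n → X.carrier) :
    push f ψ = none ↔ ∃ j, f.toFun (ψ j) = none := by
  simp [push]

theorem vals_hochschild {m : ℕ} (F : (funMod k n P).obj (op (fin m))) (ψ : Fin n → Fin (m + 1)) :
    vals (hochschild (funMod k n P) m F) ψ =
      ∑ i : Fin (m + 2), (-1 : ℤ) ^ i.val • (push (coface m i) ψ).elim 0 (vals F) := by
  rw [hochschild_apply, map_sum, Finset.sum_apply]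
  exact Finset.sum_congr rfl fun i _ => by rw [map_zsmul, Pi.smul_apply, vals_pull]

theorem mem_harrison_one (M : Comm1Mod k) (x : M.obj (op (fin 1))) : x ∈ harrison M 1 := by
  rw [mem_harrison]
  intro p h0 h1
  omega

theorem word_eq_take_append {m : ℕ} (ψ : Fin n → Fin m) (i : Fin m) :
    word ψ = (word ψ).take i.val ++ {j | ψ j = i} :: (word ψ).drop (i.val + 1) := by
  have h : (word ψ)[i.val]'(by simp) = {j | ψ j = i} := by simp [word]
  rw [← h, ← List.drop_eq_getElem_cons, List.take_append_drop]

theorem apply_eq_length_of_word_eq {m : ℕ} {ψ : Fin n → Fin m} {u v : List (Set (Fin n))}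
    {a : Set (Fin n)} (h : word ψ = u ++ a :: v) {j : Fin n} (hj : j ∈ a) :
    (ψ j).val = u.length := by
  have hl : u.length < m := by
    rw [← length_word ψ, h]
    simp
  have h1 : a = {j | ψ j = ⟨u.length, hl⟩} := by
    have h2 : (word ψ)[u.length]'(by simpa using hl) = a := by simp [h]
    rw [← h2]
    simp [word]
  rw [h1] at hj
  exact congrArg Fin.val hj

/-- An element that vanishes on signed shuffles is determined by its values on the words whose first
letter is the one that contains `j₀`. -/
theorem eq_zero_of_mem_harrison (j₀ : Fin n) {m : ℕ} (F : (funMod k n P).obj (op (fin m)))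
    (hF : F ∈ harrison (funMod k n P) m)
    (h0 : ∀ ψ : Fin n → Fin m, (ψ j₀).val = 0 → vals F ψ = 0) : F = 0 := by
  suffices h : ∀ (l : ℕ) (ψ : Fin n → Fin m), (ψ j₀).val = l → vals F ψ = 0 by
    refine vals.injective (funext fun ψ => ?_)
    rw [h _ ψ rfl, map_zero, Pi.zero_apply]
  intro l
  induction l using Nat.strong_induction_on with
  | _ l ih =>
    intro ψ hψ
    obtain rfl | hl := Nat.eq_zero_or_pos l
    · exact h0 ψ hψ
    have hlm : l < m := hψ ▸ (ψ j₀).isLt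
    have hs := (mem_harrison_funMod F (onWords (vals F)) fun ψ => onWords_word _ ψ).1 hF l hl hlm ψ
    have hw := word_eq_take_append ψ ⟨l, hlm⟩
    have hd : (word ψ).drop l = {j | ψ j = ⟨l, hlm⟩} :: (word ψ).drop (l + 1) := by
      have h1 : (word ψ)[l]'(by simpa using hlm) = {j | ψ j = ⟨l, hlm⟩} := by simp [word]
      rw [← h1, ← List.drop_eq_getElem_cons]
    rw [hd, signedShuffle_eq_of_forall_eq_zero] at hs
    · rwa [← hw, onWords_word] at hs
    · intro u v hu
      by_cases he : ∃ φ : Fin n → Fin m, word φ = u ++ {j | ψ j = ⟨l, hlm⟩} :: v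
      · obtain ⟨φ, hφ⟩ := he
        rw [← hφ, onWords_word]
        refine ih u.length (by simp at hu; omega) φ ?_
        exact apply_eq_length_of_word_eq hφ (Fin.ext hψ)
      · exact Function.extend_apply' _ _ _ he

open Classical in
/-- The element that vanishes on signed shuffles and takes the same values as `F` on the words whose
first letter is the one that contains `j₀`. -/
noncomputable def extend (j₀ : Fin n) (m : ℕ) :
    (funMod k n P).obj (op (fin m)) →ₗ[k] (funMod k n P).obj (op (fin m)) where
  toFun F := vals.symm fun ψ => lieExtend (fun s => j₀ ∈ s) (onWords (vals F)) (word ψ)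
  map_add' F G := by
    rw [← map_add]
    congr 1
    ext ψ
    rw [Pi.add_apply, ← lieExtend_add]
    congr 1
    ext w
    have := congrFun (Function.extend_add word (vals F) (vals G) (0 : List (Set (Fin n)) → P) 0) w
    rw [add_zero] at this
    rw [map_add]
    exact this
  map_smul' c F := by
    rw [RingHom.id_apply, ← map_smul]
    congr 1
    ext ψ
    rw [Pi.smul_apply]
    refine Eq.trans ?_ (map_lieExtend _ (DistribSMul.toAddMonoidHom P c) _ _).symm
    congr 1
    ext w
    have := congrFun (Function.extend_smul c word (vals F) (0 : List (Set (Fin n)) → P)) w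
    rw [smul_zero] at this
    rw [map_smul]
    exact this

open Classical in
theorem vals_extend (j₀ : Fin n) {m : ℕ} (F : (funMod k n P).obj (op (fin m)))
    (ψ : Fin n → Fin m) :
    vals (extend j₀ m F) ψ = lieExtend (fun s => j₀ ∈ s) (onWords (vals F)) (word ψ) := rfl

theorem extend_mem_harrison (j₀ : Fin n) {m : ℕ} (F : (funMod k n P).obj (op (fin m))) :
    extend j₀ m F ∈ harrison (funMod k n P) m := by
  classical
  rw [mem_harrison_funMod _ _ fun ψ => (vals_extend j₀ F ψ).symm]
  intro p h0 hm ψ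
  refine signedShuffle_lieExtend _ _ _ _ ?_ ?_ <;> rw [← List.length_pos_iff] <;> simp <;> omega

theorem vals_extend_of_eq_zero (j₀ : Fin n) {m : ℕ} (F : (funMod k n P).obj (op (fin m)))
    (ψ : Fin n → Fin m) (h : (ψ j₀).val = 0) : vals (extend j₀ m F) ψ = vals F ψ := by
  classical
  have hm := (ψ j₀).isLt
  have hw := word_eq_take_append ψ (ψ j₀)
  rw [h, List.take_zero, List.nil_append] at hw
  rw [vals_extend, hw, lieExtend_cons, ← hw, onWords_word]
  · rfl
  · intro b hb hj
    obtain ⟨s, t, hst⟩ := List.append_of_mem hb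
    rw [hst] at hw
    have := apply_eq_length_of_word_eq (u := {j | ψ j = ψ j₀} :: s) hw hj
    simp [h] at this

/-- The map that sends `j₀` to a new smallest element and agrees with `ψ` otherwise. -/
def splitOff {m : ℕ} (j₀ : Fin n) (ψ : Fin n → Fin m) : Fin n → Fin (m + 1) :=
  fun j => if j = j₀ then 0 else (ψ j).succ

/-- The pullback of functions along `splitOff j₀`. -/
def splitPull (j₀ : Fin n) (m : ℕ) :
    (funMod k n P).obj (op (fin (m + 1))) →ₗ[k] (funMod k n P).obj (op (fin m)) :=
  vals.symm.toLinearMap ∘ₗ LinearMap.funLeft k P (splitOff j₀) ∘ₗ vals.toLinearMap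

theorem vals_splitPull (j₀ : Fin n) {m : ℕ} (F : (funMod k n P).obj (op (fin (m + 1))))
    (ψ : Fin n → Fin m) : vals (splitPull j₀ m F) ψ = vals F (splitOff j₀ ψ) := rfl

theorem push_coface_zero {m : ℕ} (j₀ : Fin n) (ψ : Fin n → Fin (m + 1)) (h : (ψ j₀).val = 0) :
    push (coface m 0) ψ = none :=
  push_of_eq_none _ _ j₀ (by simp [coface, Fin.ext (b := 0) h])

theorem push_coface_one_splitOff {m : ℕ} (j₀ : Fin n) (ψ : Fin n → Fin (m + 1))
    (h : (ψ j₀).val = 0) : push (coface (m + 1) 1) (splitOff j₀ ψ) = some ψ := by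
  rw [push_eq_some_iff]
  intro j
  by_cases hj : j = j₀
  · subst hj
    simp [coface, splitOff, Fin.ext (b := 0) h]
  · simp [coface, splitOff, hj]

theorem push_coface_splitOff {m : ℕ} (hm : 0 < m) (j₀ : Fin n) (ψ : Fin n → Fin (m + 1))
    (h : (ψ j₀).val = 0) (i : Fin (m + 1)) :
    push (coface (m + 1) i.succ.succ) (splitOff j₀ ψ) =
      (push (coface m i.succ) ψ).map (splitOff j₀) := by
  have hzero : (coface m i.succ).toFun (ψ j₀) = some ⟨0, hm⟩ := by
    simp [coface, Fin.ext (b := 0) h, hm]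
  cases hp : push (coface m i.succ) ψ with
  | none =>
    obtain ⟨j, hj⟩ := (push_eq_none_iff _ _).1 hp
    have hne : j ≠ j₀ := by
      rintro rfl
      rw [hzero] at hj
      simp at hj
    refine push_of_eq_none _ _ j ?_
    simp only [coface, splitOff, hne, if_false, Fin.val_succ] at hj ⊢
    split_ifs at hj ⊢ <;> first | rfl | omega
  | some φ =>
    rw [push_eq_some_iff] at hp
    rw [Option.map_some, push_eq_some_iff]
    intro j
    by_cases hj : j = j₀
    · subst hj
      simp [coface, splitOff]
    · have := hp j
      simp only [coface, splitOff, hj, if_false, Fin.val_succ] at this ⊢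
      split_ifs at this ⊢ <;> simp only [Option.some.injEq, Fin.ext_iff,
        Fin.val_succ] at this ⊢ <;> omega

/-- On the words whose first letter contains `j₀`, splitting off `j₀` is an extra degeneracy: it undoes
the product of the first two letters and commutes with the other terms of the differential. -/
theorem hochschild_splitPull (j₀ : Fin n) {m : ℕ} (hm : 0 < m)
    (F : (funMod k n P).obj (op (fin (m + 1)))) (ψ : Fin n → Fin (m + 1)) (h : (ψ j₀).val = 0) :
    vals (splitPull j₀ (m + 1) (hochschild (funMod k n P) (m + 1) F)) ψ +
      vals (hochschild (funMod k n P) m (splitPull j₀ m F)) ψ = - vals F ψ := by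
  rw [vals_splitPull, vals_hochschild, vals_hochschild, Fin.sum_univ_succ, Fin.sum_univ_succ,
    Fin.sum_univ_succ (n := m + 1), push_coface_zero j₀ ψ h,
    push_coface_zero j₀ _ (by simp [splitOff])]
  have h1 : push (coface (m + 1) (Fin.succ 0)) (splitOff j₀ ψ) = some ψ :=
    push_coface_one_splitOff j₀ ψ h
  rw [h1]
  have h2 : ∀ i : Fin (m + 1), (push (coface (m + 1) i.succ.succ) (splitOff j₀ ψ)).elim 0 (vals F) =
      (push (coface m i.succ) ψ).elim 0 (vals (splitPull j₀ m F)) := by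
    intro i
    rw [push_coface_splitOff hm j₀ ψ h]
    cases push (coface m i.succ) ψ <;> rfl
  simp only [h2, Option.elim_none, Option.elim_some, smul_zero, zero_add, Fin.val_succ, Fin.val_zero,
    pow_succ, pow_zero, mul_neg, mul_one, neg_neg, neg_smul, one_smul,
    Finset.sum_neg_distrib]
  abel

/-- On the words whose first letter contains `j₀`, the differential involves only such words. -/
theorem hochschild_extend (j₀ : Fin n) {m : ℕ} (hm : 0 < m)
    (F : (funMod k n P).obj (op (fin m))) (ψ : Fin n → Fin (m + 1)) (h : (ψ j₀).val = 0) :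
    vals (hochschild (funMod k n P) m (extend j₀ m F)) ψ =
      vals (hochschild (funMod k n P) m F) ψ := by
  rw [vals_hochschild, vals_hochschild]
  refine Finset.sum_congr rfl fun i _ => ?_
  congr 1
  cases hp : push (coface m i) ψ with
  | none => rfl
  | some φ =>
    refine vals_extend_of_eq_zero j₀ F φ ?_
    have := (push_eq_some_iff _ _ _).1 hp j₀
    simp only [coface, h] at this
    split_ifs at this <;> simp [Fin.ext_iff] at this <;> omega

/-- The contracting homotopy of the derivation complex of `X ↦ Fun(Xⁿ, P)`. For `n = 0` the complex is
`P → P → 0 → …`, and the homotopy is the identity of `P`. For `n > 0` the sign is the one with which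
the product of the first two letters occurs in the differential. -/
noncomputable def contract (k : Type u) [Field k] (P : Type u) [AddCommGroup P] [Module k P] :
    (n m : ℕ) → (funMod k n P).obj (op (fin (m + 1))) →ₗ[k] (funMod k n P).obj (op (fin m))
  | 0, m => if m = 1 then vals.symm.toLinearMap ∘ₗ
      LinearMap.funLeft k P (fun _ => Fin.elim0) ∘ₗ vals.toLinearMap else 0
  | _ + 1, m => -(extend 0 m ∘ₗ splitPull 0 m)

theorem contract_mem_harrison (n m : ℕ) (F : (funMod k n P).obj (op (fin (m + 1)))) :
    contract k P n m F ∈ harrison (funMod k n P) m := by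
  obtain _ | n := n
  · by_cases hm : m = 1
    · subst hm
      exact mem_harrison_one _ _
    · rw [contract, if_neg hm]
      exact zero_mem _
  · exact neg_mem (extend_mem_harrison _ _)

/-- For `n = 0` every partial map acts as the identity of `P`. -/
theorem vals_hochschild_zero {m : ℕ} (F : (funMod k 0 P).obj (op (fin m)))
    (ψ : Fin 0 → Fin (m + 1)) (φ : Fin 0 → Fin m) :
    vals (hochschild (funMod k 0 P) m F) ψ = ∑ i : Fin (m + 2), (-1 : ℤ) ^ i.val • vals F φ := by
  rw [vals_hochschild]
  refine Finset.sum_congr rfl fun i _ => ?_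
  have h : push (coface m i) ψ = some φ := (push_eq_some_iff _ _ _).2 fun j => j.elim0
  rw [h]
  rfl

theorem harrison_funMod_zero [CharZero k] {m : ℕ} (hm : 2 < m)
    (F : (funMod k 0 P).obj (op (fin m))) (hF : F ∈ harrison (funMod k 0 P) m) : F = 0 := by
  refine vals.injective (funext fun ψ => ?_)
  have h := (mem_harrison_funMod F (fun _ => vals F ψ)
    fun φ => congrArg (vals F) (Subsingleton.elim _ _)).1 hF 2 (by omega) hm ψ
  obtain ⟨a, b, hab⟩ := List.length_eq_two.1 (show ((word ψ).take 2).length = 2 by simp; omega)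
  rw [hab] at h
  obtain ⟨c, hc⟩ := exists_signedShuffle_pair_eq (V := P) a b ((word ψ).drop 2)
  rw [hc, ← Nat.cast_smul_eq_nsmul k, smul_eq_zero] at h
  rw [map_zero, Pi.zero_apply]
  exact h.resolve_left (Nat.cast_ne_zero.2 (Nat.succ_ne_zero c))

theorem contract_zero_one (F : (funMod k 0 P).obj (op (fin 2))) (ψ : Fin 0 → Fin 1)
    (φ : Fin 0 → Fin 2) : vals (contract k P 0 1 F) ψ = vals F φ := by
  rw [Subsingleton.elim φ Fin.elim0]
  rfl

/-- In positive degrees `contract` is a contracting homotopy. -/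
theorem hochschild_contract_add [CharZero k] (n : ℕ) {m : ℕ} (hm : 0 < m)
    (F : (funMod k n P).obj (op (fin (m + 1)))) (hF : F ∈ harrison (funMod k n P) (m + 1)) :
    hochschild (funMod k n P) m (contract k P n m F) +
      contract k P n (m + 1) (hochschild (funMod k n P) (m + 1) F) = F := by
  obtain _ | n := n
  · by_cases h1 : m = 1
    · subst h1
      have h2 : contract k P 0 (1 + 1) = 0 := rfl
      rw [h2, LinearMap.zero_apply, add_zero]
      refine vals.injective (funext fun ψ => ?_)
      rw [vals_hochschild_zero _ _ Fin.elim0, contract_zero_one _ _ ψ, Fin.sum_univ_three]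
      simp
    · rw [harrison_funMod_zero (by omega) F hF]
      simp
  · rw [← sub_eq_zero]
    refine eq_zero_of_mem_harrison 0 _ (sub_mem (add_mem ?_ ?_) hF) fun ψ h => ?_
    · exact hochschild_mem _ _ _ (contract_mem_harrison _ _ _)
    · exact contract_mem_harrison _ _ _
    · simp only [contract, LinearMap.neg_apply, LinearMap.comp_apply, map_neg, map_sub, map_add,
        Pi.sub_apply, Pi.add_apply, Pi.neg_apply]
      rw [hochschild_extend 0 hm _ _ h, vals_extend_of_eq_zero 0 _ _ h, ← neg_add_rev,
        hochschild_splitPull 0 hm F ψ h]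
      simp

theorem contract_hochschild_one (n : ℕ) (hn : n ≠ 1) (F : (funMod k n P).obj (op (fin 1))) :
    contract k P n 1 (hochschild (funMod k n P) 1 F) = F := by
  refine vals.injective (funext fun ψ => ?_)
  obtain _ | n := n
  · rw [contract_zero_one _ ψ Fin.elim0, vals_hochschild_zero _ _ ψ, Fin.sum_univ_three]
    simp
  · have h : (ψ 0).val = 0 := by simp
    simp only [contract, LinearMap.neg_apply, LinearMap.comp_apply, map_neg, Pi.neg_apply]
    rw [vals_extend_of_eq_zero 0 _ _ h, vals_splitPull, vals_hochschild, Fin.sum_univ_three,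
      push_coface_zero 0 _ (by simp [splitOff]), push_coface_one_splitOff 0 ψ h]
    -- As `n > 1`, the last letter is not empty after splitting off `0`.
    have h2 : push (coface 1 2) (splitOff 0 ψ) = none := by
      have hne : (⟨1, by omega⟩ : Fin (n + 1)) ≠ 0 := fun e => Nat.one_ne_zero (congrArg Fin.val e)
      refine push_of_eq_none _ _ (i := ⟨1, by omega⟩) ?_
      simp [coface, splitOff, hne]
    rw [h2]
    simp

theorem hochschild_one_eq_zero (F : (funMod k 1 P).obj (op (fin 1))) :
    hochschild (funMod k 1 P) 1 F = 0 := by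
  have h0 : ∀ ψ φ : Fin 1 → Fin 1, ψ = φ := fun ψ φ => Subsingleton.elim _ _
  refine vals.injective (funext fun ψ => ?_)
  rw [vals_hochschild, Fin.sum_univ_three, map_zero, Pi.zero_apply]
  have h1 : push (coface 1 1) ψ = some fun _ => 0 := by
    rw [push_eq_some_iff]
    intro j
    have e : ((1 : Fin (1 + 2)) : ℕ) = 1 := rfl
    simp only [coface, e]
    split_ifs <;> first | exact congrArg some (Subsingleton.elim _ _) | omega
  by_cases h : ψ 0 = 0
  · have h2 : push (coface 1 2) ψ = some fun _ => 0 := by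
      rw [push_eq_some_iff]
      intro j
      rw [Subsingleton.elim j 0, h]
      simp [coface]
    rw [push_coface_zero 0 _ (by simp [h]), h1, h2]
    simp
  · have h2 : push (coface 1 0) ψ = some fun _ => 0 := by
      rw [push_eq_some_iff]
      intro j
      rw [Subsingleton.elim j 0, Fin.eq_one_of_ne_zero _ h]
      simp [coface]
    have h3 : push (coface 1 2) ψ = none := by
      refine push_of_eq_none _ _ 0 ?_
      rw [Fin.eq_one_of_ne_zero _ h]
      simp [coface]
    rw [h1, h2, h3]
    simp

section Naturality

variable {P' : Type u} [AddCommGroup P'] [Module k P']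

/-- The module `X ↦ Fun(Xⁿ, P)` is functorial in `P`. -/
def funModMap (n : ℕ) (g : P →ₗ[k] P') : funMod k n P ⟶ funMod k n P' where
  app X := ModuleCat.ofHom (g.compLeft (Fin n → X.unop.carrier))
  naturality X Y f := by
    refine ModuleCat.hom_ext (LinearMap.ext fun F => funext fun ψ => ?_)
    change g ((push f.unop ψ).elim 0 (vals F)) = (push f.unop ψ).elim 0 (fun φ => g (vals F φ))
    cases push f.unop ψ
    · exact map_zero g
    · rfl

theorem vals_funModMap (g : P →ₗ[k] P') {X : FinPart} (F : (funMod k n P).obj (op X))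
    (ψ : Fin n → X.carrier) : vals (((funModMap n g).app (op X)).hom F) ψ = g (vals F ψ) := rfl

theorem onWords_comp (g : P →ₗ[k] P') {m : ℕ} (F : (Fin n → Fin m) → P) (w : List (Set (Fin n))) :
    onWords (fun ψ => g (F ψ)) w = g (onWords F w) := by
  by_cases h : ∃ ψ : Fin n → Fin m, word ψ = w
  · obtain ⟨ψ, rfl⟩ := h
    simp
  · unfold onWords
    rw [Function.extend_apply' _ _ _ h, Function.extend_apply' _ _ _ h]
    exact (map_zero g).symm

theorem contract_funModMap (n m : ℕ) (g : P →ₗ[k] P') (F : (funMod k n P).obj (op (fin (m + 1)))) :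
    contract k P' n m (((funModMap n g).app _).hom F) =
      ((funModMap n g).app _).hom (contract k P n m F) := by
  classical
  refine vals.injective (funext fun ψ => ?_)
  rw [vals_funModMap]
  obtain _ | n := n
  · by_cases hm : m = 1
    · subst hm
      rw [contract_zero_one _ ψ Fin.elim0, contract_zero_one _ ψ Fin.elim0, vals_funModMap]
    · simp only [contract, if_neg hm, LinearMap.zero_apply, map_zero, Pi.zero_apply]
  · simp only [contract, LinearMap.neg_apply, LinearMap.comp_apply, map_neg, Pi.neg_apply]
    rw [vals_extend, vals_extend, map_lieExtend]
    congr 2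
    ext w
    exact onWords_comp g (fun ψ => vals F (splitOff 0 ψ)) w

end Naturality

end Contraction

/-! ### Total complexes of bicomplexes with contractible columns -/

section Total

open Limits

variable {C : Type*} [Category C] [Preadditive C]

/-- A deformation retraction of the columns of a bicomplex onto a complex `A` placed in the row `0`,
compatible with the differentials between the columns. -/
structure ColumnRetraction (K : HomologicalComplex₂ C (ComplexShape.up ℤ) (ComplexShape.up ℕ))
    (A : CochainComplex C ℤ) where
  /-- the inclusion of `A` -/
  i (p : ℤ) : A.X p ⟶ (K.X p).X 0
  /-- the projection to `A` -/
  r (p : ℤ) : (K.X p).X 0 ⟶ A.X p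
  /-- the homotopy -/
  h (p : ℤ) (q : ℕ) : (K.X p).X (q + 1) ⟶ (K.X p).X q
  i_comm (p p' : ℤ) : i p ≫ (K.d p p').f 0 = A.d p p' ≫ i p'
  r_comm (p p' : ℤ) : r p ≫ A.d p p' = (K.d p p').f 0 ≫ r p'
  h_comm (p p' : ℤ) (q : ℕ) : h p q ≫ (K.d p p').f q = (K.d p p').f (q + 1) ≫ h p' q
  i_r (p : ℤ) : i p ≫ r p = 𝟙 _
  i_d (p : ℤ) : i p ≫ (K.X p).d 0 1 = 0
  d_h (p : ℤ) : (K.X p).d 0 1 ≫ h p 0 + r p ≫ i p = 𝟙 _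
  d_h_add (p : ℤ) (q : ℕ) :
    (K.X p).d (q + 1) (q + 2) ≫ h p (q + 1) + h p q ≫ (K.X p).d q (q + 1) = 𝟙 _

namespace ColumnRetraction

variable {K : HomologicalComplex₂ C (ComplexShape.up ℤ) (ComplexShape.up ℕ)}
  {A : CochainComplex C ℤ} (S : ColumnRetraction K A) [K.HasTotal (ComplexShape.up ℤ)]

theorem π_eq_iff (p : ℤ) (q : ℕ) (m : ℤ) :
    ComplexShape.π (ComplexShape.up ℤ) (ComplexShape.up ℕ) (ComplexShape.up ℤ) (p, q) = m ↔
      p + q = m := Iff.rfl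

theorem ι_d (p : ℤ) (q : ℕ) (m m' : ℤ) (hm : p + q = m) (hm' : m + 1 = m') :
    K.ιTotal (ComplexShape.up ℤ) p q m hm ≫ (K.total (ComplexShape.up ℤ)).d m m' =
      (K.d p (p + 1)).f q ≫ K.ιTotal (ComplexShape.up ℤ) (p + 1) q m'
        (by rw [π_eq_iff]; omega) +
      p.negOnePow • (K.X p).d q (q + 1) ≫ K.ιTotal (ComplexShape.up ℤ) p (q + 1) m'
        (by rw [π_eq_iff]; push_cast; omega) := by
  rw [HomologicalComplex₂.total_d, Preadditive.comp_add, HomologicalComplex₂.ι_D₁,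
    HomologicalComplex₂.ι_D₂,
    K.d₁_eq (ComplexShape.up ℤ) (i₁ := p) (i₁' := p + 1) rfl q m' (by rw [π_eq_iff]; omega),
    K.d₂_eq (ComplexShape.up ℤ) p (i₂ := q) (i₂' := q + 1) rfl m'
      (by rw [π_eq_iff]; push_cast; omega)]
  congr 1
  exact one_smul _ _

/-- The inclusion of `A` as the row `0` of the total complex. -/
noncomputable def inclusion : A ⟶ K.total (ComplexShape.up ℤ) where
  f p := S.i p ≫ K.ιTotal (ComplexShape.up ℤ) p 0 p (by rw [π_eq_iff]; simp)
  comm' p p' hp := by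
    obtain rfl : p + 1 = p' := hp
    rw [Category.assoc, ι_d _ _ _ _ (by simp) rfl, Preadditive.comp_add, Linear.comp_units_smul,
      ← Category.assoc, ← Category.assoc, S.i_d, S.i_comm, zero_comp, smul_zero, add_zero,
      Category.assoc]

/-- The projection of the total complex to `A`, which vanishes on the other rows. -/
noncomputable def projectionX (m : ℤ) : (K.total (ComplexShape.up ℤ)).X m ⟶ A.X m :=
  K.totalDesc fun p q hm => match q with
    | 0 => S.r p ≫ (A.XIsoOfEq (show p = m by simpa [π_eq_iff] using hm)).hom
    | _ + 1 => 0

theorem ι_projectionX_zero (p m : ℤ) (hm : p + ((0 : ℕ) : ℤ) = m) :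
    K.ιTotal (ComplexShape.up ℤ) p 0 m hm ≫ S.projectionX m =
      S.r p ≫ (A.XIsoOfEq (show p = m by simpa using hm)).hom := by
  rw [projectionX, HomologicalComplex₂.ι_totalDesc]

theorem ι_projectionX_succ (p : ℤ) (q : ℕ) (m : ℤ) (hm : p + ((q + 1 : ℕ) : ℤ) = m) :
    K.ιTotal (ComplexShape.up ℤ) p (q + 1) m hm ≫ S.projectionX m = 0 := by
  rw [projectionX, HomologicalComplex₂.ι_totalDesc]

/-- The projection of the total complex to `A`, as a map of complexes. -/
noncomputable def projection : K.total (ComplexShape.up ℤ) ⟶ A where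
  f m := S.projectionX m
  comm' m m' hm := by
    obtain rfl : m + 1 = m' := hm
    refine HomologicalComplex₂.total.hom_ext _ fun p q hpq => ?_
    replace hpq : p + (q : ℤ) = m := hpq
    rw [← Category.assoc, ← Category.assoc, ι_d p q m (m + 1) hpq rfl, Preadditive.add_comp,
      Linear.units_smul_comp, Category.assoc, Category.assoc, Category.assoc, ι_projectionX_succ, comp_zero,
      smul_zero, add_zero]
    obtain _ | q := q
    · obtain rfl : p = m := by simpa using hpq
      rw [← Category.assoc (K.ιTotal _ p 0 p hpq), ι_projectionX_zero, ι_projectionX_zero]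
      simp [S.r_comm]
    · rw [← Category.assoc (K.ιTotal _ p (q + 1) m hpq), ι_projectionX_succ, ι_projectionX_succ,
        zero_comp, comp_zero]

/-- The homotopy on the total complex. The sign makes it anticommute with the differentials between
the columns. -/
noncomputable def homotopyX (m m' : ℤ) :
    (K.total (ComplexShape.up ℤ)).X m ⟶ (K.total (ComplexShape.up ℤ)).X m' :=
  K.totalDesc fun p q _ => match q with
    | 0 => 0
    | q + 1 => p.negOnePow • S.h p q ≫ K.ιTotalOrZero (ComplexShape.up ℤ) p q m'

theorem ι_homotopyX_zero (p m m' : ℤ) (hm : p + ((0 : ℕ) : ℤ) = m) :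
    K.ιTotal (ComplexShape.up ℤ) p 0 m hm ≫ S.homotopyX m m' = 0 := by
  rw [homotopyX, HomologicalComplex₂.ι_totalDesc]

theorem ι_homotopyX_succ (p : ℤ) (q : ℕ) (m m' : ℤ) (hm : p + ((q + 1 : ℕ) : ℤ) = m)
    (hm' : p + q = m') :
    K.ιTotal (ComplexShape.up ℤ) p (q + 1) m hm ≫ S.homotopyX m m' =
      p.negOnePow • S.h p q ≫ K.ιTotal (ComplexShape.up ℤ) p q m' hm' := by
  rw [homotopyX, HomologicalComplex₂.ι_totalDesc, ← K.ιTotalOrZero_eq]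

theorem homotopyX_eq_zero (m m' : ℤ) (h : m' + 1 ≠ m) : S.homotopyX m m' = 0 := by
  refine HomologicalComplex₂.total.hom_ext _ fun p q hpq => ?_
  rw [comp_zero]
  obtain _ | q := q
  · exact S.ι_homotopyX_zero _ _ _ hpq
  · rw [homotopyX, HomologicalComplex₂.ι_totalDesc]
    dsimp only
    rw [K.ιTotalOrZero_eq_zero, comp_zero, smul_zero]
    rw [π_eq_iff] at hpq
    rw [Ne, π_eq_iff]
    push_cast at hpq
    omega

/-- The homotopy between the identity of the total complex and the projection to the row `0`. -/
noncomputable def homotopy :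
    Homotopy (𝟙 (K.total (ComplexShape.up ℤ))) (S.projection ≫ S.inclusion) where
  hom m m' := S.homotopyX m m'
  zero m m' h := S.homotopyX_eq_zero m m' h
  comm m := by
    rw [dNext_eq _ (show (ComplexShape.up ℤ).Rel m (m + 1) from rfl),
      prevD_eq _ (show (ComplexShape.up ℤ).Rel (m - 1) m from by simp)]
    refine HomologicalComplex₂.total.hom_ext _ fun p q hpq => ?_
    replace hpq : p + (q : ℤ) = m := hpq
    rw [HomologicalComplex.id_f, HomologicalComplex.comp_f, Preadditive.comp_add,
      Preadditive.comp_add, ← Category.assoc, ι_d p q m (m + 1) hpq rfl, Preadditive.add_comp,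
      Linear.units_smul_comp, Category.assoc, Category.assoc,
      ι_homotopyX_succ _ _ _ _ _ _ hpq, Linear.comp_units_smul, smul_smul,
      Int.units_mul_self, one_smul, ← Category.assoc (K.ιTotal _ p q m hpq) (S.homotopyX _ _),
      ← Category.assoc (K.ιTotal _ p q m hpq) (S.projection.f m)]
    obtain _ | q := q
    · obtain rfl : p = m := by simpa using hpq
      change _ = _ + _ + (_ ≫ S.projectionX p) ≫ S.inclusion.f p
      rw [ι_homotopyX_zero, ι_homotopyX_zero, ι_projectionX_zero, comp_zero, zero_comp, zero_add,
        add_zero]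
      have := congrArg (· ≫ K.ιTotal (ComplexShape.up ℤ) p 0 p hpq) (S.d_h p)
      simp only [Preadditive.add_comp, Category.assoc, Category.id_comp] at this
      simp [inclusion, this]
    · change _ = _ + _ + (_ ≫ S.projectionX m) ≫ S.inclusion.f m
      have e : p + (q : ℤ) = m - 1 := by push_cast at hpq; omega
      have e' : p + 1 + (q : ℤ) = m := by omega
      rw [ι_projectionX_succ, ι_homotopyX_succ _ _ _ _ _ _ e,
        ι_homotopyX_succ _ _ _ _ _ _ e', Linear.units_smul_comp, Category.assoc, ι_d _ _ _ _ e (by omega),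
        Preadditive.comp_add, Linear.comp_units_smul, Linear.comp_units_smul, smul_add, smul_smul,
        Int.units_mul_self, one_smul, zero_comp, add_zero, Int.negOnePow_succ, Units.neg_smul]
      have h1 := congrArg (· ≫ K.ιTotal (ComplexShape.up ℤ) p (q + 1) m hpq) (S.d_h_add p q)
      have h2 := congrArg (· ≫ K.ιTotal (ComplexShape.up ℤ) (p + 1) q m (by rw [π_eq_iff]; omega))
        (S.h_comm p (p + 1) q)
      simp only [Preadditive.add_comp, Category.assoc, Category.id_comp] at h1 h2
      rw [h2, Category.comp_id]
      refine h1.symm.trans ?_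
      abel

/-- The inclusion of `A` in the total complex is a homotopy equivalence. -/
noncomputable def homotopyEquiv : HomotopyEquiv A (K.total (ComplexShape.up ℤ)) where
  hom := S.inclusion
  inv := S.projection
  homotopyHomInvId := Homotopy.ofEq (by
    ext p
    rw [HomologicalComplex.comp_f, HomologicalComplex.id_f]
    change (_ ≫ _) ≫ S.projectionX p = _
    rw [Category.assoc, ι_projectionX_zero]
    simp [S.i_r])
  homotopyInvHomId := S.homotopy.symm

end ColumnRetraction

end Total

/-! ### The module `J(P)` as a retract of a module of functions -/

section Invariants

open MonoidalCategory TensorProduct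

variable {k : Type u} [Field k] {n : ℕ} (P : Rep.{u} k (Equiv.Perm (Fin n)))

/-- The inclusion of `J(P)(X)` in `J_n(X) ⊗ P`. -/
noncomputable def invVal (X : FinPart) :
    ((J k n).obj P).obj (op X) →ₗ[k] multilinear k n X ⊗[k] P :=
  ((Jn k n).obj (op X) ⊗ P : Rep k _).ρ.invariants.subtype

theorem invVal_pull {X Y : FinPart} (f : X ⟶ Y) (x : ((J k n).obj P).obj (op Y)) :
    invVal P X (pull ((J k n).obj P) f x) =
      LinearMap.rTensor P ((coprod k n f).toLinearMap.restrict (coprod_mem n f))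
        (invVal P Y x) := rfl

theorem invVal_map {Q : Rep.{u} k (Equiv.Perm (Fin n))} (g : P ⟶ Q) {X : FinPart}
    (x : ((J k n).obj P).obj (op X)) :
    invVal Q X ((((J k n).map g).app (op X)).hom x) =
      LinearMap.lTensor (multilinear k n X) g.hom.toLinearMap (invVal P X x) := rfl

variable [CharZero k]

noncomputable instance invertible_card_perm :
    Invertible (Fintype.card (Equiv.Perm (Fin n)) : k) :=
  invertibleOfNonzero (Nat.cast_ne_zero.2 Fintype.card_ne_zero)

/-- The projection of `J_n(X) ⊗ P` to `J(P)(X)` by averaging over the symmetric group. -/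
noncomputable def invProj (X : FinPart) :
    multilinear k n X ⊗[k] P →ₗ[k] ((J k n).obj P).obj (op X) :=
  (((Jn k n).obj (op X) ⊗ P : Rep k _).ρ.averageMap).codRestrict _
    (Representation.averageMap_invariant _)

theorem invProj_invVal (X : FinPart) (x : ((J k n).obj P).obj (op X)) :
    invProj P X (invVal P X x) = x :=
  Subtype.ext (Representation.averageMap_id _ _ x.2)

theorem averageMap_hom {A B : Rep.{u} k (Equiv.Perm (Fin n))} (f : A ⟶ B) (x : A) :
    B.ρ.averageMap (f.hom x) = f.hom (A.ρ.averageMap x) := by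
  simp only [Representation.averageMap, GroupAlgebra.average, map_smul, map_sum]
  simp [Rep.hom_comm_apply]

theorem invProj_pull {X Y : FinPart} (f : X ⟶ Y) (x : multilinear k n Y ⊗[k] P) :
    pull ((J k n).obj P) f (invProj P Y x) =
      invProj P X
        (LinearMap.rTensor P ((coprod k n f).toLinearMap.restrict (coprod_mem n f)) x) :=
  Subtype.ext (averageMap_hom ((Jn k n).map f.op ▷ P) x).symm

theorem invProj_map {Q : Rep.{u} k (Equiv.Perm (Fin n))} (g : P ⟶ Q) {X : FinPart}
    (x : multilinear k n X ⊗[k] P) :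
    (((J k n).map g).app (op X)).hom (invProj P X x) =
      invProj Q X (LinearMap.lTensor (multilinear k n X) g.hom.toLinearMap x) :=
  Subtype.ext (averageMap_hom ((Jn k n).obj (op X) ◁ g) x).symm

theorem invVal_invProj (P : Rep.{u} k (Equiv.Perm (Fin 1))) (X : FinPart)
    (x : multilinear k 1 X ⊗[k] P) : invVal P X (invProj P X x) = x := by
  refine Representation.averageMap_id ((Jn k 1).obj (op X) ⊗ P : Rep k _).ρ x fun g => ?_
  rw [Subsingleton.elim g 1, map_one]
  rfl

end Invariants

section Monomials

open TensorProduct MvPolynomial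

/-- The exponents of the monomial in `⊗_{x ∈ X} SV` in which `e_i` occurs once, in the factor `ψ i`. -/
noncomputable def expo {n : ℕ} {X : FinPart} (ψ : Fin n → X.carrier) : X.carrier × Fin n →₀ ℕ :=
  ∑ i, Finsupp.single (ψ i, i) 1

open Classical in
theorem expo_apply {n : ℕ} {X : FinPart} (ψ : Fin n → X.carrier) (x : X.carrier) (i : Fin n) :
    expo ψ (x, i) = if ψ i = x then 1 else 0 := by
  rw [expo, Finsupp.finsetSum_apply, Finset.sum_eq_single i]
  · simp [Finsupp.single_apply]
  · intro j _ hj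
    simp [hj]
  · simp

theorem expo_injective {n : ℕ} {X : FinPart} :
    Function.Injective (expo : (Fin n → X.carrier) → _) := by
  classical
  intro ψ φ h
  ext i
  have := congrArg (fun d => d (φ i, i)) h
  simp only [expo_apply, if_true] at this
  by_contra hne
  simp [hne] at this

theorem weight_expo {n : ℕ} {X : FinPart} (ψ : Fin n → X.carrier) :
    Finsupp.weight (gr n X) (expo ψ) = fun _ => 1 := by
  rw [expo, map_sum]
  simp only [Finsupp.weight_single, gr, one_smul]
  exact Finset.univ_sum_single (fun _ => 1)

theorem exists_eq_expo {n : ℕ} {X : FinPart} (d : X.carrier × Fin n →₀ ℕ)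
    (hd : Finsupp.weight (gr n X) d = fun _ => 1) : ∃ ψ : Fin n → X.carrier, expo ψ = d := by
  classical
  have h1 : ∀ i, ∑ x, d (x, i) = 1 := by
    intro i
    have := congrFun hd i
    rw [Finsupp.weight_apply, Finsupp.sum_fintype _ _ (by simp), Finset.sum_apply,
      Fintype.sum_prod_type] at this
    simpa [gr, Pi.single_apply] using this
  have h2 : ∀ i, ∃ x, ∀ y, d (y, i) = if x = y then 1 else 0 := by
    intro i
    obtain ⟨x, -, hx⟩ := Finset.exists_ne_zero_of_sum_ne_zero ((h1 i).trans_ne one_ne_zero)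
    refine ⟨x, fun y => ?_⟩
    have hs := Finset.add_sum_erase Finset.univ (fun y => d (y, i)) (Finset.mem_univ x)
    simp only [h1] at hs
    split_ifs with hxy
    · subst hxy
      omega
    · have := Finset.single_le_sum (f := fun y => d (y, i)) (fun _ _ => Nat.zero_le _)
        (Finset.mem_erase.2 ⟨Ne.symm hxy, Finset.mem_univ y⟩)
      omega
  choose ψ hψ using h2
  refine ⟨ψ, ?_⟩
  ext ⟨y, i⟩
  rw [expo_apply, hψ]

variable {k : Type u} [Field k] {n : ℕ}

/-- The monomial in which `e_i` occurs in the factor `ψ i`. These form a basis of `J_n(X)`. -/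
noncomputable def mon {X : FinPart} (ψ : Fin n → X.carrier) : multilinear k n X :=
  ⟨monomial (expo ψ) 1, by
    rw [multilinear, mem_weightedHomogeneousSubmodule]
    exact isWeightedHomogeneous_monomial _ _ _ (weight_expo ψ)⟩

theorem mon_val {X : FinPart} (ψ : Fin n → X.carrier) :
    (mon ψ : multilinear k n X).1 = ∏ i, MvPolynomial.X (ψ i, i) :=
  monomial_sum_one _ _

theorem coprod_mon {X Y : FinPart} (f : X ⟶ Y) (φ : Fin n → Y.carrier)
    [DecidableEq (Option (Fin n → Y.carrier))] :
    (coprod k n f).toLinearMap.restrict (coprod_mem n f) (mon φ) =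
      ∑ ψ : Fin n → X.carrier with push f ψ = some φ, mon ψ := by
  classical
  refine Subtype.ext ?_
  change coprod k n f (mon φ).1 = _
  rw [mon_val, map_prod]
  simp only [coprod, aeval_X]
  rw [Finset.prod_univ_sum, AddSubmonoidClass.coe_finsetSum]
  simp only [mon_val]
  refine Finset.sum_congr ?_ fun _ _ => rfl
  ext ψ
  simp [push_eq_some_iff]

theorem sum_coeff_smul_mon {X : FinPart} (p : multilinear k n X) :
    ∑ ψ : Fin n → X.carrier, coeff (expo ψ) p.1 • mon ψ = p := by
  classical
  refine Subtype.ext ?_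
  rw [AddSubmonoidClass.coe_finsetSum]
  ext d
  simp only [coeff_sum, SetLike.val_smul, coeff_smul, mon, coeff_monomial, smul_eq_mul, mul_ite,
    mul_one, mul_zero]
  by_cases h : ∃ ψ : Fin n → X.carrier, expo ψ = d
  · obtain ⟨ψ, rfl⟩ := h
    simp [expo_injective.eq_iff]
  · rw [Finset.sum_eq_zero fun ψ _ => if_neg fun e => h ⟨ψ, e⟩]
    by_contra hne
    exact h (exists_eq_expo d (p.2 (Ne.symm hne)))

variable (P : Type u) [AddCommGroup P] [Module k P]

/-- The element of `J_n(X) ⊗ P` with given coefficients. -/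
noncomputable def fromCoeff (X : FinPart) :
    (funMod k n P).obj (op X) →ₗ[k] multilinear k n X ⊗[k] P :=
  (∑ ψ : Fin n → X.carrier, TensorProduct.mk k _ P (mon ψ) ∘ₗ LinearMap.proj ψ) ∘ₗ
    vals.toLinearMap

theorem fromCoeff_apply (X : FinPart) (F : (funMod k n P).obj (op X)) :
    fromCoeff P X F = ∑ ψ : Fin n → X.carrier, mon ψ ⊗ₜ[k] vals F ψ := by
  simp [fromCoeff]

/-- The coefficients of an element of `J_n(X) ⊗ P`. -/
noncomputable def toCoeff (X : FinPart) :
    multilinear k n X ⊗[k] P →ₗ[k] (funMod k n P).obj (op X) :=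
  vals.symm.toLinearMap ∘ₗ LinearMap.pi fun ψ =>
    TensorProduct.lift (LinearMap.lsmul k P ∘ₗ lcoeff k (expo ψ) ∘ₗ (multilinear k n X).subtype)

theorem vals_toCoeff_tmul (X : FinPart) (p : multilinear k n X) (v : P) (ψ : Fin n → X.carrier) :
    vals (toCoeff P X (p ⊗ₜ v)) ψ = coeff (expo ψ) p.1 • v := rfl

theorem toCoeff_fromCoeff (X : FinPart) (F : (funMod k n P).obj (op X)) :
    toCoeff P X (fromCoeff P X F) = F := by
  classical
  refine vals.injective (funext fun ψ => ?_)
  rw [fromCoeff_apply, map_sum, map_sum, Finset.sum_apply]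
  simp only [vals_toCoeff_tmul, mon, coeff_monomial, ite_smul, one_smul, zero_smul,
    expo_injective.eq_iff]
  simp

theorem fromCoeff_toCoeff (X : FinPart) (t : multilinear k n X ⊗[k] P) :
    fromCoeff P X (toCoeff P X t) = t := by
  induction t using TensorProduct.induction_on with
  | zero => simp
  | add s t hs ht => rw [map_add, map_add, hs, ht]
  | tmul p v =>
    rw [fromCoeff_apply]
    simp only [vals_toCoeff_tmul, TensorProduct.tmul_smul, TensorProduct.smul_tmul']
    rw [← TensorProduct.sum_tmul, sum_coeff_smul_mon]

theorem fromCoeff_pull {X Y : FinPart} (f : X ⟶ Y) (F : (funMod k n P).obj (op Y)) :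
    fromCoeff P X (pull (funMod k n P) f F) =
      LinearMap.rTensor P ((coprod k n f).toLinearMap.restrict (coprod_mem n f))
        (fromCoeff P Y F) := by
  classical
  rw [fromCoeff_apply, fromCoeff_apply, map_sum]
  simp only [LinearMap.rTensor_tmul, coprod_mon, TensorProduct.sum_tmul, Finset.sum_filter]
  rw [Finset.sum_comm]
  refine Finset.sum_congr rfl fun ψ _ => ?_
  rw [vals_pull]
  cases push f ψ <;> simp [TensorProduct.ite_tmul]

theorem toCoeff_pull {X Y : FinPart} (f : X ⟶ Y) (t : multilinear k n Y ⊗[k] P) :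
    pull (funMod k n P) f (toCoeff P Y t) =
      toCoeff P X
        (LinearMap.rTensor P ((coprod k n f).toLinearMap.restrict (coprod_mem n f)) t) := by
  rw [← toCoeff_fromCoeff P X (pull _ _ _), fromCoeff_pull, fromCoeff_toCoeff]

variable {P}

theorem fromCoeff_map {Q : Type u} [AddCommGroup Q] [Module k Q] (g : P →ₗ[k] Q) {X : FinPart}
    (F : (funMod k n P).obj (op X)) :
    fromCoeff Q X (((funModMap n g).app (op X)).hom F) =
      LinearMap.lTensor (multilinear k n X) g (fromCoeff P X F) := by
  rw [fromCoeff_apply, fromCoeff_apply, map_sum]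
  exact Finset.sum_congr rfl fun ψ _ => rfl

theorem toCoeff_map {Q : Type u} [AddCommGroup Q] [Module k Q] (g : P →ₗ[k] Q) {X : FinPart}
    (t : multilinear k n X ⊗[k] P) :
    ((funModMap n g).app (op X)).hom (toCoeff P X t) =
      toCoeff Q X (LinearMap.lTensor (multilinear k n X) g t) := by
  rw [← toCoeff_fromCoeff Q X (((funModMap n g).app (op X)).hom _), fromCoeff_map,
    fromCoeff_toCoeff]

end Monomials

section Retract

variable {k : Type u} [Field k] {n : ℕ} (P : Rep.{u} k (Equiv.Perm (Fin n)))

/-- The inclusion of `J(P)` in the module `X ↦ Fun(Xⁿ, P)`, by the coefficients of monomials. -/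
noncomputable def toFunMod : (J k n).obj P ⟶ funMod k n P where
  app X := ModuleCat.ofHom (toCoeff P X.unop ∘ₗ invVal P X.unop)
  naturality X Y f := by
    refine ModuleCat.hom_ext (LinearMap.ext fun x => ?_)
    exact (congrArg _ (invVal_pull P f.unop x)).trans (toCoeff_pull P f.unop _).symm

theorem toFunMod_map {Q : Rep.{u} k (Equiv.Perm (Fin n))} (g : P ⟶ Q) :
    (J k n).map g ≫ toFunMod Q = toFunMod P ≫ funModMap n g.hom.toLinearMap := by
  ext X : 2
  refine ModuleCat.hom_ext (LinearMap.ext fun x => ?_)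
  exact (congrArg _ (invVal_map P g x)).trans (toCoeff_map g.hom.toLinearMap _).symm

variable [CharZero k]

/-- The projection of `X ↦ Fun(Xⁿ, P)` to `J(P)`, by averaging over the symmetric group. -/
noncomputable def ofFunMod : funMod k n P ⟶ (J k n).obj P where
  app X := ModuleCat.ofHom (invProj P X.unop ∘ₗ fromCoeff P X.unop)
  naturality X Y f := by
    refine ModuleCat.hom_ext (LinearMap.ext fun x => ?_)
    exact (congrArg _ (fromCoeff_pull P f.unop x)).trans (invProj_pull P f.unop _).symm

theorem ofFunMod_map {Q : Rep.{u} k (Equiv.Perm (Fin n))} (g : P ⟶ Q) :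
    funModMap n g.hom.toLinearMap ≫ ofFunMod Q = ofFunMod P ≫ (J k n).map g := by
  ext X : 2
  refine ModuleCat.hom_ext (LinearMap.ext fun x => ?_)
  exact (congrArg _ (fromCoeff_map g.hom.toLinearMap x)).trans (invProj_map P g _).symm

theorem toFunMod_ofFunMod : toFunMod P ≫ ofFunMod P = 𝟙 _ := by
  ext X : 2
  refine ModuleCat.hom_ext (LinearMap.ext fun x => ?_)
  exact (congrArg _ (fromCoeff_toCoeff P X.unop _)).trans (invProj_invVal P X.unop x)

theorem ofFunMod_toFunMod (P : Rep.{u} k (Equiv.Perm (Fin 1))) :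
    ofFunMod P ≫ toFunMod P = 𝟙 _ := by
  ext X : 2
  refine ModuleCat.hom_ext (LinearMap.ext fun x => ?_)
  exact (congrArg _ (invVal_invProj P X.unop _)).trans (toCoeff_fromCoeff P X.unop x)

end Retract

/-! ### The derivation complex of `J(P)` -/

section DerivationComplex

variable {k : Type u} [Field k]

theorem hochschild_natural {M N : Comm1Mod k} (φ : M ⟶ N) {m : ℕ} (x : M.obj (op (fin m))) :
    (φ.app _).hom (hochschild M m x) = hochschild N m ((φ.app _).hom x) := by
  rw [hochschild_apply, hochschild_apply, map_sum]
  exact Finset.sum_congr rfl fun i _ => by rw [map_zsmul, pull_natural]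

/-- The element of `M` that underlies a cochain. -/
noncomputable def cochainVal (M : Comm1Mod k) (q : ℕ) :
    (harrisonComplex M).X q →ₗ[k] M.obj (op (fin (q + 1))) :=
  (harrison M (q + 1)).subtype

theorem cochainVal_injective (M : Comm1Mod k) (q : ℕ) : Function.Injective (cochainVal M q) :=
  Subtype.val_injective

theorem cochainVal_mem (M : Comm1Mod k) (q : ℕ) (x : (harrisonComplex M).X q) :
    cochainVal M q x ∈ harrison M (q + 1) := Subtype.property _

theorem harrisonComplex_d (M : Comm1Mod k) (q : ℕ) : (harrisonComplex M).d q (q + 1) =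
    ModuleCat.ofHom ((hochschild M (q + 1)).restrict fun x hx => hochschild_mem M (q + 1) x hx) := by
  simp only [harrisonComplex, CochainComplex.of_d]

theorem cochainVal_d (M : Comm1Mod k) (q : ℕ) (x : (harrisonComplex M).X q) :
    cochainVal M (q + 1) (((harrisonComplex M).d q (q + 1)).hom x) =
      hochschild M (q + 1) (cochainVal M q x) := by
  rw [harrisonComplex_d]
  rfl

variable [CharZero k] {n : ℕ}

theorem ofFunMod_toFunMod_apply (P : Rep.{u} k (Equiv.Perm (Fin 1))) {X : FinPart}
    (F : (funMod k 1 P).obj (op X)) :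
    ((toFunMod P).app (op X)).hom (((ofFunMod P).app (op X)).hom F) = F :=
  congrArg (fun φ => (φ.app (op X)).hom F) (ofFunMod_toFunMod P)

theorem toFunMod_ofFunMod_apply (P : Rep.{u} k (Equiv.Perm (Fin n))) {X : FinPart}
    (x : ((J k n).obj P).obj (op X)) :
    ((ofFunMod P).app (op X)).hom (((toFunMod P).app (op X)).hom x) = x :=
  congrArg (fun φ => (φ.app (op X)).hom x) (toFunMod_ofFunMod P)

/-- The map `contract` on the retract `J(P)` of `X ↦ Fun(Xⁿ, P)`. -/
noncomputable def contractJ (P : Rep.{u} k (Equiv.Perm (Fin n))) (m : ℕ) :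
    ((J k n).obj P).obj (op (fin (m + 1))) →ₗ[k] ((J k n).obj P).obj (op (fin m)) :=
  ((ofFunMod P).app _).hom ∘ₗ contract k P n m ∘ₗ ((toFunMod P).app _).hom

theorem contractJ_apply (P : Rep.{u} k (Equiv.Perm (Fin n))) {m : ℕ}
    (x : ((J k n).obj P).obj (op (fin (m + 1)))) : contractJ P m x =
      ((ofFunMod P).app _).hom (contract k P n m (((toFunMod P).app _).hom x)) := rfl

theorem contractJ_mem_harrison (P : Rep.{u} k (Equiv.Perm (Fin n))) {m : ℕ}
    (x : ((J k n).obj P).obj (op (fin (m + 1)))) : contractJ P m x ∈ harrison _ m :=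
  harrison_map (ofFunMod P) (contract k P n m (((toFunMod P).app _).hom x))
    (contract_mem_harrison _ _ _)

theorem contractJ_map {P Q : Rep.{u} k (Equiv.Perm (Fin n))} (g : P ⟶ Q) {m : ℕ}
    (x : ((J k n).obj P).obj (op (fin (m + 1)))) :
    (((J k n).map g).app _).hom (contractJ P m x) =
      contractJ Q m ((((J k n).map g).app _).hom x) := by
  have h1 : ∀ y, (((J k n).map g).app (op (fin m))).hom (((ofFunMod P).app _).hom y) =
      ((ofFunMod Q).app _).hom (((funModMap n g.hom.toLinearMap).app _).hom y) := fun y =>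
    congrArg (fun φ => (φ.app (op (fin m))).hom y) (ofFunMod_map P g).symm
  have h2 : ((toFunMod Q).app (op (fin (m + 1)))).hom ((((J k n).map g).app _).hom x) =
      ((funModMap n g.hom.toLinearMap).app _).hom (((toFunMod P).app _).hom x) :=
    congrArg (fun φ => (φ.app (op (fin (m + 1)))).hom x) (toFunMod_map P g)
  rw [contractJ_apply, contractJ_apply, h1, h2, contract_funModMap]

theorem hochschild_contractJ_add (P : Rep.{u} k (Equiv.Perm (Fin n))) {m : ℕ} (hm : 0 < m)
    (x : ((J k n).obj P).obj (op (fin (m + 1)))) (hx : x ∈ harrison _ (m + 1)) :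
    hochschild _ m (contractJ P m x) + contractJ P (m + 1) (hochschild _ (m + 1) x) = x := by
  rw [contractJ_apply, contractJ_apply, ← hochschild_natural, hochschild_natural (toFunMod P),
    ← map_add, hochschild_contract_add n hm _ (harrison_map _ _ hx), toFunMod_ofFunMod_apply]

theorem contractJ_hochschild_one (P : Rep.{u} k (Equiv.Perm (Fin n))) (hn : n ≠ 1)
    (x : ((J k n).obj P).obj (op (fin 1))) : contractJ P 1 (hochschild _ 1 x) = x := by
  rw [contractJ_apply, hochschild_natural (toFunMod P), contract_hochschild_one n hn,
    toFunMod_ofFunMod_apply]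

theorem hochschild_J_one_eq_zero (P : Rep.{u} k (Equiv.Perm (Fin 1)))
    (x : ((J k 1).obj P).obj (op (fin 1))) : hochschild _ 1 x = 0 := by
  rw [← toFunMod_ofFunMod_apply P x, ← hochschild_natural, hochschild_one_eq_zero, map_zero]

/-- The isomorphism of `P` with the part of degree zero of the derivation complex of `J(P)`, if
`n = 1`. -/
noncomputable def unitJ (P : Rep.{u} k (Equiv.Perm (Fin 1))) :
    P.V ≃ₗ[k] ((J k 1).obj P).obj (op (fin 1)) where
  toLinearMap := ((ofFunMod P).app (op (fin 1))).hom ∘ₗ vals.symm.toLinearMap ∘ₗ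
    LinearMap.pi fun _ => LinearMap.id
  invFun x := vals (((toFunMod P).app (op (fin 1))).hom x) fun _ => 0
  left_inv v := by
    simp only [AddHom.toFun_eq_coe, LinearMap.coe_toAddHom, LinearMap.comp_apply]
    rw [ofFunMod_toFunMod_apply]
    rfl
  right_inv x := by
    refine Eq.trans ?_ (toFunMod_ofFunMod_apply P x)
    refine congrArg ((ofFunMod P).app (op (fin 1))).hom (vals.injective (funext fun ψ => ?_))
    exact congrArg (vals (((toFunMod P).app (op (fin 1))).hom x)) (Subsingleton.elim _ _)

theorem unitJ_map {P Q : Rep.{u} k (Equiv.Perm (Fin 1))} (g : P ⟶ Q) (v : P) :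
    (((J k 1).map g).app _).hom (unitJ P v) = unitJ Q (g.hom v) :=
  congrArg (fun φ => (φ.app (op (fin 1))).hom (vals.symm fun _ => v)) (ofFunMod_map P g).symm

/-- The contracting homotopy of the derivation complex of `J(P)`. -/
noncomputable def cochainHomotopy (P : Rep.{u} k (Equiv.Perm (Fin n))) (q : ℕ) :
    (harrisonComplex ((J k n).obj P)).X (q + 1) ⟶ (harrisonComplex ((J k n).obj P)).X q :=
  ModuleCat.ofHom ((contractJ P (q + 1)).restrict fun x _ => contractJ_mem_harrison P x)

theorem cochainVal_cochainHomotopy (P : Rep.{u} k (Equiv.Perm (Fin n))) (q : ℕ)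
    (x : (harrisonComplex ((J k n).obj P)).X (q + 1)) :
    cochainVal _ q ((cochainHomotopy P q).hom x) = contractJ P (q + 1) (cochainVal _ (q + 1) x) :=
  rfl

theorem cochainHomotopy_map {P Q : Rep.{u} k (Equiv.Perm (Fin n))} (g : P ⟶ Q) (q : ℕ) :
    cochainHomotopy P q ≫ ((harrisonFunctor k).map ((J k n).map g)).f q =
      ((harrisonFunctor k).map ((J k n).map g)).f (q + 1) ≫ cochainHomotopy Q q :=
  ModuleCat.hom_ext (LinearMap.ext fun x =>
    cochainVal_injective _ _ (contractJ_map g (cochainVal _ _ x)))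

theorem d_cochainHomotopy_add (P : Rep.{u} k (Equiv.Perm (Fin n))) (q : ℕ) :
    (harrisonComplex ((J k n).obj P)).d (q + 1) (q + 2) ≫ cochainHomotopy P (q + 1) +
      cochainHomotopy P q ≫ (harrisonComplex ((J k n).obj P)).d q (q + 1) = 𝟙 _ := by
  refine ModuleCat.hom_ext (LinearMap.ext fun x => cochainVal_injective _ _ ?_)
  rw [ModuleCat.hom_add, LinearMap.add_apply, map_add, ModuleCat.hom_comp, ModuleCat.hom_comp,
    LinearMap.comp_apply, LinearMap.comp_apply, cochainVal_cochainHomotopy, cochainVal_d,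
    cochainVal_d, cochainVal_cochainHomotopy]
  exact (add_comm _ _).trans
    (hochschild_contractJ_add P (Nat.succ_pos q) _ (cochainVal_mem _ _ x))

theorem d_cochainHomotopy_zero (P : Rep.{u} k (Equiv.Perm (Fin n))) (hn : n ≠ 1) :
    (harrisonComplex ((J k n).obj P)).d 0 1 ≫ cochainHomotopy P 0 = 𝟙 _ := by
  refine ModuleCat.hom_ext (LinearMap.ext fun x => cochainVal_injective _ _ ?_)
  rw [ModuleCat.hom_comp, LinearMap.comp_apply, cochainVal_cochainHomotopy, cochainVal_d]
  exact contractJ_hochschild_one P hn _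

theorem harrisonComplex_J_one_d_zero (P : Rep.{u} k (Equiv.Perm (Fin 1))) :
    (harrisonComplex ((J k 1).obj P)).d 0 1 = 0 := by
  refine ModuleCat.hom_ext (LinearMap.ext fun x => cochainVal_injective _ _ ?_)
  rw [cochainVal_d]
  exact hochschild_J_one_eq_zero P _

/-- The isomorphism of `P` with the cochains of degree zero of the derivation complex of `J(P)`, if
`n = 1`. -/
noncomputable def cochainUnit (P : Rep.{u} k (Equiv.Perm (Fin 1))) :
    (forget₂ (Rep.{u} k (Equiv.Perm (Fin 1))) (ModuleCat.{u} k)).obj P ≅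
      (harrisonComplex ((J k 1).obj P)).X 0 where
  hom := ModuleCat.ofHom ((unitJ P).toLinearMap.codRestrict (harrison _ 1)
    fun _ => mem_harrison_one _ _)
  inv := ModuleCat.ofHom ((unitJ P).symm.toLinearMap ∘ₗ cochainVal _ 0)
  hom_inv_id := ModuleCat.hom_ext (LinearMap.ext fun v => (unitJ P).symm_apply_apply v)
  inv_hom_id := ModuleCat.hom_ext (LinearMap.ext fun x =>
    cochainVal_injective _ _ ((unitJ P).apply_symm_apply (cochainVal _ 0 x)))

theorem cochainUnit_map {P Q : Rep.{u} k (Equiv.Perm (Fin 1))} (g : P ⟶ Q) :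
    (cochainUnit P).hom ≫ ((harrisonFunctor k).map ((J k 1).map g)).f 0 =
      (forget₂ (Rep.{u} k (Equiv.Perm (Fin 1))) (ModuleCat.{u} k)).map g ≫ (cochainUnit Q).hom :=
  ModuleCat.hom_ext (LinearMap.ext fun v => cochainVal_injective _ _ (unitJ_map g v))

theorem cochainUnit_inv_map {P Q : Rep.{u} k (Equiv.Perm (Fin 1))} (g : P ⟶ Q) :
    (cochainUnit P).inv ≫ (forget₂ (Rep.{u} k (Equiv.Perm (Fin 1))) (ModuleCat.{u} k)).map g =
      ((harrisonFunctor k).map ((J k 1).map g)).f 0 ≫ (cochainUnit Q).inv := by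
  refine ModuleCat.hom_ext (LinearMap.ext fun x => ?_)
  have h := unitJ_map g ((unitJ P).symm (cochainVal _ 0 x))
  rw [(unitJ P).apply_symm_apply (cochainVal _ 0 x)] at h
  exact ((unitJ Q).symm_apply_eq.2 h).symm

theorem d_cochainHomotopy_add_unit (P : Rep.{u} k (Equiv.Perm (Fin 1))) :
    (harrisonComplex ((J k 1).obj P)).d 0 1 ≫ cochainHomotopy P 0 +
      (cochainUnit P).inv ≫ (cochainUnit P).hom = 𝟙 _ := by
  rw [harrisonComplex_J_one_d_zero, Limits.zero_comp, zero_add, Iso.inv_hom_id]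

/-- The bicomplex whose total complex is the derivation complex of `J(P)`. -/
noncomputable abbrev bicomplexJ (P : CochainComplex (Rep.{u} k (Equiv.Perm (Fin n))) ℤ) :
    HomologicalComplex₂ (ModuleCat.{u} k) (ComplexShape.up ℤ) (ComplexShape.up ℕ) :=
  ((harrisonFunctor k).mapHomologicalComplex (ComplexShape.up ℤ)).obj
    (((J k n).mapHomologicalComplex (ComplexShape.up ℤ)).obj P)

/-- If `n ≠ 1`, the columns are contractible. -/
noncomputable def columnRetractionZero (hn : n ≠ 1)
    (P : CochainComplex (Rep.{u} k (Equiv.Perm (Fin n))) ℤ) :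
    ColumnRetraction (bicomplexJ P) HomologicalComplex.zero where
  i _ := 0
  r _ := 0
  h p := cochainHomotopy (P.X p)
  i_comm _ _ := by simp
  r_comm _ _ := by simp
  h_comm p p' := cochainHomotopy_map (P.d p p')
  i_r _ := (Limits.isZero_zero _).eq_of_src _ _
  i_d _ := by simp
  d_h p := by
    rw [Limits.zero_comp, add_zero]
    exact d_cochainHomotopy_zero (P.X p) hn
  d_h_add p := d_cochainHomotopy_add (P.X p)

/-- If `n = 1`, the columns retract to `P`. -/
noncomputable def columnRetractionOne (P : CochainComplex (Rep.{u} k (Equiv.Perm (Fin 1))) ℤ) :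
    ColumnRetraction (bicomplexJ P)
      (((forget₂ (Rep.{u} k (Equiv.Perm (Fin 1))) (ModuleCat.{u} k)).mapHomologicalComplex
        (ComplexShape.up ℤ)).obj P) where
  i p := (cochainUnit (P.X p)).hom
  r p := (cochainUnit (P.X p)).inv
  h p := cochainHomotopy (P.X p)
  i_comm p p' := cochainUnit_map (P.d p p')
  r_comm p p' := cochainUnit_inv_map (P.d p p')
  h_comm p p' := cochainHomotopy_map (P.d p p')
  i_r p := (cochainUnit (P.X p)).hom_inv_id
  i_d p := (congrArg _ (harrisonComplex_J_one_d_zero (P.X p))).trans Limits.comp_zero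
  d_h p := d_cochainHomotopy_add_unit (P.X p)
  d_h_add p := d_cochainHomotopy_add (P.X p)

end DerivationComplex

end CommOne

/-- For a complex `P` of representations of `S_n` over a field of characteristic zero, the derivation
complex of `J(P)` is acyclic if `n ≠ 1`, and for `n = 1` it is quasi-isomorphic to `P`. -/
theorem theorem6p3 (k : Type u) [Field k] [CharZero k] :
    (∀ n : ℕ, n ≠ 1 → ∀ P : CochainComplex (Rep.{u} k (Equiv.Perm (Fin n))) ℤ,
      (CommOne.derivationComplex
        (((CommOne.J k n).mapHomologicalComplex (ComplexShape.up ℤ)).obj P)).Acyclic) ∧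
    (∀ P : CochainComplex (Rep.{u} k (Equiv.Perm (Fin 1))) ℤ,
      ∃ f : ((forget₂ (Rep.{u} k (Equiv.Perm (Fin 1))) (ModuleCat.{u} k)).mapHomologicalComplex
            (ComplexShape.up ℤ)).obj P ⟶
          CommOne.derivationComplex
            (((CommOne.J k 1).mapHomologicalComplex (ComplexShape.up ℤ)).obj P),
        QuasiIso f) := by
  refine ⟨fun n hn P m => ?_, fun P => ?_⟩
  · let e := (CommOne.columnRetractionZero hn P).homotopyEquiv
    have hq : QuasiIso e.hom := inferInstance
    refine (exactAt_iff_of_quasiIsoAt e.hom m).1 ?_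
    exact ShortComplex.exact_of_isZero_X₂ _ (Limits.isZero_zero _)
  · let e := (CommOne.columnRetractionOne P).homotopyEquiv
    have hq : QuasiIso e.hom := inferInstance
    exact ⟨e.hom, hq⟩
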